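/- Let $N\ge 2$ be an integer, $I=[0,1]$, $x_i=i/N$ for $0\le i\le N$, and let $y_0,\dots,y_N\in\mathbb R$ with $y_0=y_N=0$. Let $L_i(x)=(x+i-1)/N$, which maps $I$ onto $I_i=[x_{i-1},x_i]$ ($1\le i\le N$), and let $h$ be the continuous function on $I$ that is linear on each $I_i$ and satisfies $h(x_i)=y_i$ for all $i$. Let $S:I\to\mathbb R$ satisfy $|S(x)|<1$ for all $x\in I$ and $|S(x')-S(x'')|\le\lambda_S|x'-x''|$ for all $x',x''\in I$, where $\lambda_S>0$ is a constant. Let $f:I\to\mathbb R$ be the corresponding generalized affine fractal interpolation function, i.e. the continuous function whose graph $\Gamma f=\{(x,f(x)):x\in I\}$ satisfies $\Gamma f=\bigcup_{i=1}^N W_i(\Gamma f)$, where $W_i(x,y)=\big(L_i(x),\,S(L_i(x))\,y+h(L_i(x))\big)$. For $k\ge1$, $1\le j\le N^k$ and $1\le i\le N$ put $I^k_j=\big[\tfrac{j-1}{N^k},\tfrac{j}{N^k}\big]$ and $I^k_{i,j}=L_i(I^k_j)$. Let $M_k$ be the $N^k\times N^k$ matrix whose entry in row $(i-1)N^{k-1}+\ell$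 (where $1\le i\le N$, $1\le\ell\le N^{k-1}$) and column $j$ is $\max_{I^k_{i,j}}|S|$ if $(\ell-1)N<j\le\ell N$, and $0$ otherwise; let $M'_k$ be the matrix defined in the same way with $\min_{I^k_{i,j}}|S|$ in place of the maximum. Write $\rho(\cdot)$ for the spectral radius. Put $\gamma(x)=\sum_{i=1}^N|S(L_i(x))|$, $\gamma_*=\min_{x\in I}\gamma(x)$, $M_f=\max_{x\in I}|f(x)|$, and $O_k(f,I)=\sum_{j=1}^{N^k}\sup_{x',x''\in I^k_j}|f(x')-f(x'')|$. Suppose that $S(x)>0$ for all $x\in I$, that $\gamma_*>1$, and that there is an integer $k_0\ge1$ with $$O_{k_0}(f,I)>\frac{\lambda_S M_f}{\gamma_*-1}.$$ Then the limits $\lim_{k\to\infty}\rho(M_k)$ and $\lim_{k\to\infty}\rho(M'_k)$ exist and are equal; their common value $\rho_S$ is positive, and the box dimension of $\Gamma f$ exists and equals $$\dim_B\Gamma f=1+\frac{\log\rho_S}{\log N}.$$ Here the upper and lower box dimensions of a bounded set $E\subset\mathbb R^2$ are the $\limsup$ and $\liminf$, as $\varepsilon\to0+$, of $\log\mathcal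 N_E(\varepsilon)/\log(1/\varepsilon)$, where $\mathcal N_E(\varepsilon)$ is the number of squares $[k_1\varepsilon,(k_1+1)\varepsilon]\times[k_2\varepsilon,(k_2+1)\varepsilon]$, $k_1,k_2\in\mathbb Z$, that meet $E$; the box dimension exists if the two agree, and is then their common value. -/

import Mathlib

open Set Filter Topology

noncomputable section

namespace GenAffineFIF

/-! ### Box dimension of planar sets -/

/-- The `ε`-coordinate square with index `k ∈ ℤ × ℤ`. -/
def coordSquare (ε : ℝ) (k : ℤ × ℤ) : Set (ℝ × ℝ) :=
  Icc (k.1 * ε) ((k.1 + 1) * ε) ×ˢ Icc (k.2 * ε) ((k.2 + 1) * ε)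

/-- The number of `ε`-coordinate squares that meet `E` (for bounded `E` and `ε > 0` it is finite). -/
def boxCount (E : Set (ℝ × ℝ)) (ε : ℝ) : ℕ :=
  {k : ℤ × ℤ | (coordSquare ε k ∩ E).Nonempty}.ncard

/-- Upper box dimension. -/
def upperBoxDim (E : Set (ℝ × ℝ)) : EReal :=
  limsup (fun ε : ℝ => ((Real.log (boxCount E ε) / Real.log (1 / ε) : ℝ) : EReal)) (𝓝[>] 0)

/-- Lower box dimension. -/
def lowerBoxDim (E : Set (ℝ × ℝ)) : EReal :=
  liminf (fun ε : ℝ => ((Real.log (boxCount E ε) / Real.log (1 / ε) : ℝ) : EReal)) (𝓝[>] 0)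

/-- The box dimension of `E` exists and equals `d`. -/
def HasBoxDim (E : Set (ℝ × ℝ)) (d : ℝ) : Prop :=
  upperBoxDim E = d ∧ lowerBoxDim E = d

/-! ### Generalized affine fractal interpolation functions -/

/-- The graph of `f` over `[a, b]`. -/
def graphOver (f : ℝ → ℝ) (a b : ℝ) : Set (ℝ × ℝ) :=
  (fun t => (t, f t)) '' Icc a b

/-- The linear function with value `u` at `a` and value `v` at `c` (where `a ≠ c`). -/
def chord (a c u v t : ℝ) : ℝ := u + (v - u) * ((t - a) / (c - a))

/-- The linear map `L_i : [x_0, x_N] → [x_{i-1}, x_i]`; here `i : Fin N` stands for `i + 1`, so that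
`i.castSucc` and `i.succ` are the indices of the left and the right end point. -/
def nodeMap {N : ℕ} (x : Fin (N + 1) → ℝ) (i : Fin N) : ℝ → ℝ :=
  chord (x 0) (x (Fin.last N)) (x i.castSucc) (x i.succ)

/-- The linear function `b` with `b(x_0) = y_0` and `b(x_N) = y_N`. -/
def baseLine {N : ℕ} (x y : Fin (N + 1) → ℝ) : ℝ → ℝ :=
  chord (x 0) (x (Fin.last N)) (y 0) (y (Fin.last N))

/-- The piecewise linear function `h` through the points `(x_i, y_i)`: the sum of `y_0` and of one
ramp for each `i`, which climbs linearly from `0` to `y_i - y_{i-1}` on `[x_{i-1}, x_i]` and is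
constant on either side. See `polyline_eq_chord`. -/
def polyline {N : ℕ} (x y : Fin (N + 1) → ℝ) (t : ℝ) : ℝ :=
  y 0 + ∑ i : Fin N, chord (x i.castSucc) (x i.succ) 0 (y i.succ - y i.castSucc)
    (max (x i.castSucc) (min (x i.succ) t))

/-- On `[x_{i-1}, x_i]` the function `h` is linear with end values `y_{i-1}` and `y_i`. -/
theorem polyline_eq_chord {N : ℕ} {x : Fin (N + 1) → ℝ} (hx : StrictMono x)
    (y : Fin (N + 1) → ℝ) (i : Fin N) {t : ℝ} (ht : t ∈ Icc (x i.castSucc) (x i.succ)) :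
    polyline x y t = chord (x i.castSucc) (x i.succ) (y i.castSucc) (y i.succ) t := by
  have hne : ∀ k : Fin N, x k.succ - x k.castSucc ≠ 0 := fun k =>
    (sub_pos.2 (hx Fin.castSucc_lt_succ)).ne'
  have key : ∀ k : Fin N, chord (x k.castSucc) (x k.succ) 0 (y k.succ - y k.castSucc)
      (max (x k.castSucc) (min (x k.succ) t)) =
      (if k < i then y k.succ - y k.castSucc else 0) +
        (if k = i then (y i.succ - y i.castSucc) *
          ((t - x i.castSucc) / (x i.succ - x i.castSucc)) else 0) := by
    intro k
    rcases lt_trichotomy k i with h | h | h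
    · have h1 : x k.succ ≤ x i.castSucc := hx.monotone (by
        simp only [Fin.le_def, Fin.val_succ, Fin.val_castSucc]; omega)
      have h2 : x k.castSucc ≤ x k.succ := (hx Fin.castSucc_lt_succ).le
      rw [min_eq_left (h1.trans ht.1), max_eq_right h2]
      simp [chord, h, h.ne, div_self (hne k)]
    · subst h
      rw [min_eq_right ht.2, max_eq_right ht.1]
      simp [chord]
    · have h1 : x i.succ ≤ x k.castSucc := hx.monotone (by
        simp only [Fin.le_def, Fin.val_succ, Fin.val_castSucc]; omega)
      rw [max_eq_left ((min_le_right _ _).trans (ht.2.trans h1))]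
      simp [chord, h.not_gt, h.ne']
  have tele : ∀ m : ℕ, ∀ hm : m < N + 1,
      ∑ k : Fin N, (if (k : ℕ) < m then y k.succ - y k.castSucc else 0) = y ⟨m, hm⟩ - y 0 := by
    intro m
    induction m with
    | zero => intro hm; simp
    | succ m ih =>
      intro hm
      have hs : ∀ k : Fin N, (if (k : ℕ) < m + 1 then y k.succ - y k.castSucc else 0) =
          (if (k : ℕ) < m then y k.succ - y k.castSucc else 0) +
          (if k = (⟨m, by omega⟩ : Fin N) then y k.succ - y k.castSucc else 0) := by
        intro k
        simp only [Fin.ext_iff]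
        split_ifs <;> first | omega | simp
      rw [Finset.sum_congr rfl fun k _ => hs k, Finset.sum_add_distrib, ih (by omega)]
      simp
  have ht' := tele i (by omega)
  simp only [← Fin.lt_def] at ht'
  rw [polyline, Finset.sum_congr rfl fun k _ => key k, Finset.sum_add_distrib, ht']
  simp only [Finset.sum_ite_eq', Finset.mem_univ, if_true, chord]
  have : (⟨(i : ℕ), by omega⟩ : Fin (N + 1)) = i.castSucc := rfl
  rw [this]; ring

/-- `F_i(t, v) = S(L_i(t)) (v - b(t)) + h(L_i(t))`. -/
def vertMap {N : ℕ} (x y : Fin (N + 1) → ℝ) (S : ℝ → ℝ) (i : Fin N) (t v : ℝ) : ℝ :=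
  S (nodeMap x i t) * (v - baseLine x y t) + polyline x y (nodeMap x i t)

/-- `W_i(t, v) = (L_i(t), F_i(t, v))`. -/
def ifsMap {N : ℕ} (x y : Fin (N + 1) → ℝ) (S : ℝ → ℝ) (i : Fin N) (p : ℝ × ℝ) : ℝ × ℝ :=
  (nodeMap x i p.1, vertMap x y S i p.1 p.2)

/-- `f` is the generalized affine fractal interpolation function of the data `(x_i, y_i)` with
vertical scaling function `S`: the continuous function on `[x_0, x_N]` whose graph is the invariant
set of the iterated function system `W_1, …, W_N`. -/
structure IsGenAffineFIF {N : ℕ} (x y : Fin (N + 1) → ℝ) (S f : ℝ → ℝ) : Prop where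
  continuousOn : ContinuousOn f (Icc (x 0) (x (Fin.last N)))
  invariant : graphOver f (x 0) (x (Fin.last N)) =
    ⋃ i : Fin N, ifsMap x y S i '' graphOver f (x 0) (x (Fin.last N))

/-- The uniformly spaced nodes `x_i = i / N` of `[0, 1]`. -/
def unifNodes (N : ℕ) (i : Fin (N + 1)) : ℝ := (i : ℕ) / (N : ℝ)

/-! ### Vertical scaling matrices
All indices below start at `0`. -/

/-- The `j`-th of the `N ^ k` subintervals of equal length of `[a, b]`, for `0 ≤ j < N ^ k`. -/
def subInterval (N : ℕ) (a b : ℝ) (k j : ℕ) : Set ℝ :=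
  Icc (a + j / (N : ℝ) ^ k * (b - a)) (a + (j + 1) / (N : ℝ) ^ k * (b - a))

/-- The `j`-th of the `N ^ k` subintervals of equal length of `[i / N, (i + 1) / N]`. -/
def cell (N k i j : ℕ) : Set ℝ := subInterval N (i / (N : ℝ)) ((i + 1) / (N : ℝ)) k j

/-- The maximum of `|S|` on a cell. -/
def upperScale (N : ℕ) (S : ℝ → ℝ) (k i j : ℕ) : ℝ := sSup ((fun x => |S x|) '' cell N k i j)

/-- The minimum of `|S|` on a cell. -/
def lowerScale (N : ℕ) (S : ℝ → ℝ) (k i j : ℕ) : ℝ := sInf ((fun x => |S x|) '' cell N k i j)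

/-- The `N ^ k × N ^ k` matrix (`k ≥ 1`) whose entry in row `i * N ^ (k - 1) + l`, where `i < N` and
`l < N ^ (k - 1)`, and column `j` is `s i j` if `l * N ≤ j < (l + 1) * N`, and `0` otherwise. -/
def scaleMatrix (N k : ℕ) (s : ℕ → ℕ → ℝ) : Matrix (Fin (N ^ k)) (Fin (N ^ k)) ℝ :=
  Matrix.of fun r j =>
    if ((r : ℕ) % N ^ (k - 1)) * N ≤ (j : ℕ) ∧ (j : ℕ) < ((r : ℕ) % N ^ (k - 1) + 1) * N then
      s ((r : ℕ) / N ^ (k - 1)) j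
    else 0

/-- The vertical scaling matrix `M_k`. -/
def upperMatrix (N : ℕ) (S : ℝ → ℝ) (k : ℕ) : Matrix (Fin (N ^ k)) (Fin (N ^ k)) ℝ :=
  scaleMatrix N k (upperScale N S k)

/-- The vertical scaling matrix `M'_k`. -/
def lowerMatrix (N : ℕ) (S : ℝ → ℝ) (k : ℕ) : Matrix (Fin (N ^ k)) (Fin (N ^ k)) ℝ :=
  scaleMatrix N k (lowerScale N S k)

/-- The spectral radius of a real square matrix: the largest modulus of a complex eigenvalue. -/
def specRadius {n : ℕ} (A : Matrix (Fin n) (Fin n) ℝ) : ℝ :=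
  (spectralRadius ℂ (A.map (fun a : ℝ => (a : ℂ)))).toReal

/-- `ρ` is the number `ρ_S`: the common limit of the spectral radii of `M_k` and of `M'_k`. -/
def IsRhoS (N : ℕ) (S : ℝ → ℝ) (ρ : ℝ) : Prop :=
  Tendsto (fun k => specRadius (upperMatrix N S k)) atTop (𝓝 ρ) ∧
    Tendsto (fun k => specRadius (lowerMatrix N S k)) atTop (𝓝 ρ)

/-! ### Sum function and oscillations -/

/-- The sum function `γ(x) = ∑ |S(L_i(x))|` for the uniform nodes of `[0, 1]`. -/
def sumFun (N : ℕ) (S : ℝ → ℝ) (t : ℝ) : ℝ := ∑ i : Fin N, |S (nodeMap (unifNodes N) i t)|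

/-- `γ_*`, the minimum of the sum function on `[0, 1]`. -/
def gammaMin (N : ℕ) (S : ℝ → ℝ) : ℝ := sInf (sumFun N S '' Icc 0 1)

/-- `M_f`, the maximum of `|f|` on `[0, 1]`. -/
def maxAbs (f : ℝ → ℝ) : ℝ := sSup ((fun t => |f t|) '' Icc 0 1)

/-- The oscillation of `g` on `U`. -/
def osc (g : ℝ → ℝ) (U : Set ℝ) : ℝ :=
  sSup {r : ℝ | ∃ s ∈ U, ∃ t ∈ U, r = |g s - g t|}

/-- `O_k(g, [a, b])`, the sum of the oscillations over the `N ^ k` equal subintervals. -/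
def oscSum (N : ℕ) (g : ℝ → ℝ) (a b : ℝ) (k : ℕ) : ℝ :=
  ∑ j ∈ Finset.range (N ^ k), osc g (subInterval N a b k j)

end GenAffineFIF

end

/-!
Weighted by `S`, the inverse branches `L_i` define a transfer operator on the functions on `[0, 1]`.
Since `log S` is Lipschitz and the branches contract, its iterates preserve a cone of log-Lipschitz
functions, which gives a positive log-Lipschitz eigenfunction `φ` with eigenvalue `ρ > 0`.

The column of `M_k` that belongs to a cell `J` of level `k` has its nonzero entries in the rows of
the cells `L_i(J')`, where `J'` is the cell of level `k - 1` that contains `J`. Since `S` and `φ`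
vary on a cell of level `k` by a factor `1 + O(N ^ (-k))`, the values of `φ` at the grid points
nearly form a left eigenvector of `M_k` and of `M'_k`, and a positive near-eigenvector of a
nonnegative matrix pins down the spectral radius: both spectral radii tend to `ρ`.

Let `O_k` be the oscillation sum of `f` and `W_k` the same sum weighted by `φ`. The functional
equation of `f` gives `|W_{k+1} - ρ W_k| ≤ C` and `O_{k+1} ≥ γ_* O_k - λ_S M_f`. The condition on
`O_{k₀}` lets the second recurrence escape its fixed point, so that `O_k → ∞`, and then `ρ > 1`
makes the first one give `O_k ≍ ρ ^ k`. Finally, the number of squares of side about `N ^ (-k)` that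
meet the graph is comparable to `N ^ k O_k`.
-/

namespace GenAffineFIF

open Asymptotics Matrix

open scoped NNReal

/-! ### Log-Lipschitz functions -/

section LogLipschitz

variable {α : Type*} [PseudoMetricSpace α] {s : Set α} {K : ℝ≥0} {g : α → ℝ}

/-- The positive functions on `s` whose logarithm is `K`-Lipschitz. The multiplicative form used
here makes it evident that they form a convex cone. -/
structure LogLipschitzOn (K : ℝ≥0) (g : α → ℝ) (s : Set α) : Prop where
  pos : ∀ x ∈ s, 0 < g x
  le_exp_mul : ∀ x ∈ s, ∀ y ∈ s, g x ≤ Real.exp (K * dist x y) * g y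

namespace LogLipschitzOn

protected theorem one : LogLipschitzOn K (1 : α → ℝ) s where
  pos _ _ := one_pos
  le_exp_mul x _ y _ := by simpa using Real.one_le_exp (by positivity : 0 ≤ K * dist x y)

theorem mono {K' : ℝ≥0} (hg : LogLipschitzOn K g s) (h : K ≤ K') : LogLipschitzOn K' g s where
  pos := hg.pos
  le_exp_mul x hx y hy := by
    have := (hg.pos y hy).le
    grw [hg.le_exp_mul x hx y hy, h]

theorem const_smul (hg : LogLipschitzOn K g s) {c : ℝ} (hc : 0 < c) :
    LogLipschitzOn K (c • g) s where
  pos x hx := mul_pos hc (hg.pos x hx)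
  le_exp_mul x hx y hy := by
    simpa only [Pi.smul_apply, smul_eq_mul, mul_left_comm] using
      mul_le_mul_of_nonneg_left (hg.le_exp_mul x hx y hy) hc.le

protected theorem mul {K' : ℝ≥0} {g' : α → ℝ} (hg : LogLipschitzOn K g s)
    (hg' : LogLipschitzOn K' g' s) : LogLipschitzOn (K + K') (g * g') s where
  pos x hx := mul_pos (hg.pos x hx) (hg'.pos x hx)
  le_exp_mul x hx y hy := by
    calc g x * g' x
        ≤ Real.exp (K * dist x y) * g y * (Real.exp (K' * dist x y) * g' y) :=
          mul_le_mul (hg.le_exp_mul x hx y hy) (hg'.le_exp_mul x hx y hy) (hg'.pos x hx).le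
            (mul_nonneg (Real.exp_pos _).le (hg.pos y hy).le)
      _ = Real.exp ((K + K' : ℝ≥0) * dist x y) * (g y * g' y) := by
          rw [NNReal.coe_add, add_mul, Real.exp_add]; ring

protected theorem sum {ι : Type*} {t : Finset ι} (ht : t.Nonempty) {g : ι → α → ℝ}
    (hg : ∀ i ∈ t, LogLipschitzOn K (g i) s) :
    LogLipschitzOn K (fun x => ∑ i ∈ t, g i x) s where
  pos x hx := Finset.sum_pos (fun i hi => (hg i hi).pos x hx) ht
  le_exp_mul x hx y hy := by
    rw [Finset.mul_sum]
    exact Finset.sum_le_sum fun i hi => (hg i hi).le_exp_mul x hx y hy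

theorem comp {β : Type*} [PseudoMetricSpace β] {t : Set β} {c : ℝ≥0} {σ : β → α}
    (hg : LogLipschitzOn K g s) (hσ : LipschitzOnWith c σ t) (hst : MapsTo σ t s) :
    LogLipschitzOn (K * c) (g ∘ σ) t where
  pos x hx := hg.pos _ (hst hx)
  le_exp_mul x hx y hy := by
    have hpos : 0 ≤ g (σ y) := (hg.pos _ (hst hy)).le
    have hdist : K * dist (σ x) (σ y) ≤ (K * c : ℝ≥0) * dist x y := by
      grw [hσ.dist_le_mul x hx y hy, NNReal.coe_mul, mul_assoc]
    refine (hg.le_exp_mul _ (hst hx) _ (hst hy)).trans ?_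
    dsimp only [Function.comp_apply]
    gcongr

theorem mem_Icc_of_dist_le (hg : LogLipschitzOn K g s) {x y : α} (hx : x ∈ s) (hy : y ∈ s) {d : ℝ}
    (hd : dist x y ≤ d) :
    g x ∈ Icc (Real.exp (-(K * d)) * g y) (Real.exp (K * d) * g y) := by
  have hgx := (hg.pos x hx).le
  have hgy := (hg.pos y hy).le
  constructor
  · rw [Real.exp_neg, inv_mul_le_iff₀ (Real.exp_pos _)]
    refine (hg.le_exp_mul y hy x hx).trans ?_
    rw [dist_comm]
    gcongr
  · refine (hg.le_exp_mul x hx y hy).trans ?_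
    gcongr

theorem exists_mem_Icc (hg : LogLipschitzOn K g s) (hs : Bornology.IsBounded s) :
    ∃ a b, 0 < a ∧ ∀ x ∈ s, g x ∈ Icc a b := by
  rcases s.eq_empty_or_nonempty with rfl | ⟨y, hy⟩
  · exact ⟨1, 1, one_pos, by simp⟩
  · exact ⟨_, _, mul_pos (Real.exp_pos _) (hg.pos y hy), fun x hx =>
      hg.mem_Icc_of_dist_le hx hy (Metric.dist_le_diam_of_mem hs hx hy)⟩

end LogLipschitzOn

theorem exists_logLipschitzOn {L : ℝ≥0} (hs : IsCompact s) (hg : LipschitzOnWith L g s)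
    (hpos : ∀ x ∈ s, 0 < g x) : ∃ K, LogLipschitzOn K g s := by
  obtain ⟨m, hm, hmg⟩ := hs.exists_forall_le' hg.continuousOn hpos
  lift m to ℝ≥0 using hm.le
  refine ⟨L / m, hpos, fun x hx y hy => ?_⟩
  calc g x ≤ g y + L * dist x y := by
        linarith [hg.dist_le_mul x hx y hy, le_abs_self (g x - g y), Real.dist_eq (g x) (g y)]
    _ ≤ g y + L * dist x y * (g y / m) := by
        gcongr g y + ?_
        exact le_mul_of_one_le_right (by positivity) ((one_le_div hm).2 (hmg y hy))
    _ = ((L / m : ℝ≥0) * dist x y + 1) * g y := by push_cast; ring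
    _ ≤ Real.exp ((L / m : ℝ≥0) * dist x y) * g y := by
        have := (hpos y hy).le
        gcongr
        exact Real.add_one_le_exp _

end LogLipschitz

/-! ### The transfer operator and its positive eigenfunction -/

theorem exists_abs_sub_natCast_mul_le {u : ℕ → ℝ} {C : ℝ}
    (h : ∀ m n, |u (m + n) - u m - u n| ≤ C) : ∃ l, ∀ n, |u n - n * l| ≤ C := by
  have hadd : Subadditive fun n => u n + C := fun m n => by linarith [(abs_le.1 (h m n)).2]
  have hsub : Subadditive fun n => C - u n := fun m n => by linarith [(abs_le.1 (h m n)).1]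
  have hcomm (m n : ℕ) : (n + 1 : ℝ) * (u (m + 1) - C) ≤ (m + 1) * (u (n + 1) + C) := by
    have h₁ := hadd.apply_mul_add_le m (n + 1) (n + 1)
    have h₂ := hsub.apply_mul_add_le n (m + 1) (m + 1)
    rw [show m * (n + 1) + (n + 1) = n * (m + 1) + (m + 1) by ring] at h₁
    linarith [abs_nonneg (u (0 + 0) - u 0 - u 0), h 0 0]
  have hle (m n : ℕ) : (u (m + 1) - C) / (m + 1) ≤ (u (n + 1) + C) / (n + 1) := by
    rw [div_le_div_iff₀ (by positivity) (by positivity)]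
    linarith [hcomm m n]
  refine ⟨⨆ m : ℕ, (u (m + 1) - C) / (m + 1), fun n => ?_⟩
  rcases n with - | n
  · simpa using h 0 0
  · have hlow := le_ciSup ⟨_, forall_mem_range.2 fun m => hle m 0⟩ n
    have hup := ciSup_le fun m => hle m n
    rw [div_le_iff₀ (by positivity)] at hlow
    rw [le_div_iff₀ (by positivity)] at hup
    rw [abs_le]
    push_cast
    constructor <;> linarith

theorem exists_mem_Icc_exp_mul_pow {u : ℕ → ℝ} {E : ℝ} (hu : ∀ n, 0 < u n)
    (h : ∀ m n, u (m + n) ∈ Icc (Real.exp (-E) * (u m * u n)) (Real.exp E * (u m * u n))) :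
    ∃ ρ, 0 < ρ ∧ ∀ n, u n ∈ Icc (Real.exp (-E) * ρ ^ n) (Real.exp E * ρ ^ n) := by
  have hlog (m n : ℕ) : |Real.log (u (m + n)) - Real.log (u m) - Real.log (u n)| ≤ E := by
    have hprod (e : ℝ) : Real.log (Real.exp e * (u m * u n)) =
        e + (Real.log (u m) + Real.log (u n)) := by
      rw [Real.log_mul (Real.exp_pos e).ne' (mul_pos (hu m) (hu n)).ne',
        Real.log_mul (hu m).ne' (hu n).ne', Real.log_exp]
    have hlow := Real.log_le_log (mul_pos (Real.exp_pos _) (mul_pos (hu m) (hu n))) (h m n).1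
    have hup := Real.log_le_log (hu _) (h m n).2
    rw [hprod] at hlow hup
    exact abs_le.2 ⟨by linarith, by linarith⟩
  obtain ⟨l, hl⟩ := exists_abs_sub_natCast_mul_le (u := fun n => Real.log (u n)) hlog
  refine ⟨Real.exp l, Real.exp_pos l, fun n => ?_⟩
  obtain ⟨hlow, hup⟩ := abs_le.1 (hl n)
  rw [← Real.exp_nat_mul, ← Real.exp_add, ← Real.exp_add, ← Real.exp_log (hu n), mem_Icc,
    Real.exp_le_exp, Real.exp_le_exp]
  constructor <;> linarith

section Transfer

variable {ι α : Type*} [Fintype ι] {s : Set α} {σ : ι → α → α} {S g h : α → ℝ}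

/-- The Ruelle transfer operator of the inverse branches `σ` with the weight `S`. -/
def transfer (σ : ι → α → α) (S : α → ℝ) : Module.End ℝ (α → ℝ) where
  toFun g x := ∑ i, S (σ i x) * g (σ i x)
  map_add' g h := by ext; simp [mul_add, Finset.sum_add_distrib]
  map_smul' c g := by ext; simp [mul_left_comm, Finset.mul_sum]

theorem transfer_apply (σ : ι → α → α) (S g : α → ℝ) (x : α) :
    transfer σ S g x = ∑ i, S (σ i x) * g (σ i x) := rfl

theorem transfer_smul_weight (c : ℝ) (σ : ι → α → α) (S : α → ℝ) :
    transfer σ (c • S) = c • transfer σ S := by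
  ext; simp [transfer_apply, mul_assoc, Finset.mul_sum]

theorem transfer_pow_mono (hσ : ∀ i, MapsTo (σ i) s s) (hS : ∀ x ∈ s, 0 ≤ S x)
    (hgh : ∀ x ∈ s, g x ≤ h x) (n : ℕ) :
    ∀ x ∈ s, (transfer σ S ^ n) g x ≤ (transfer σ S ^ n) h x := by
  induction n with
  | zero => exact hgh
  | succ n ih =>
    intro x hx
    simp only [pow_succ', Module.End.mul_apply, transfer_apply]
    exact Finset.sum_le_sum fun i _ =>
      mul_le_mul_of_nonneg_left (ih _ (hσ i hx)) (hS _ (hσ i hx))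

theorem le_of_transfer_eq_mul {φ : α → ℝ} {a c r : ℝ} (hs : s.Nonempty)
    (hσ : ∀ i, MapsTo (σ i) s s) (hS : ∀ x ∈ s, 0 ≤ S x) (ha : 0 < a) (hφ : ∀ x ∈ s, a ≤ φ x)
    (hr : ∀ x ∈ s, transfer σ S φ x = r * φ x) (hc : ∀ x ∈ s, c ≤ ∑ i, S (σ i x)) : c ≤ r := by
  set m := sInf (φ '' s)
  have hne : (φ '' s).Nonempty := hs.image φ
  have hm : ∀ x ∈ s, m ≤ φ x := fun x hx =>
    csInf_le ⟨a, forall_mem_image.2 hφ⟩ (mem_image_of_mem φ hx)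
  have hm0 : 0 < m := ha.trans_le (le_csInf hne (forall_mem_image.2 hφ))
  have hsum : ∀ x ∈ s, (∑ i, S (σ i x)) * m ≤ r * φ x := fun x hx => by
    rw [← hr x hx, transfer_apply, Finset.sum_mul]
    exact Finset.sum_le_sum fun i _ =>
      mul_le_mul_of_nonneg_left (hm _ (hσ i hx)) (hS _ (hσ i hx))
  have hr0 : 0 ≤ r := by
    obtain ⟨x, hx⟩ := hs
    exact nonneg_of_mul_nonneg_left ((mul_nonneg (Finset.sum_nonneg fun i _ => hS _ (hσ i hx))
      hm0.le).trans (hsum x hx)) (ha.trans_le (hφ x hx))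
  refine le_of_mul_le_mul_right ?_ hm0
  rw [← smul_eq_mul r, ← Real.sInf_smul_of_nonneg hr0]
  refine le_csInf hne.smul_set ?_
  rintro _ ⟨_, ⟨x, hx, rfl⟩, rfl⟩
  exact (mul_le_mul_of_nonneg_right (hc x hx) hm0.le).trans (hsum x hx)

variable [PseudoMetricSpace α] {K K_S c : ℝ≥0}

theorem LogLipschitzOn.transfer [Nonempty ι] (hS : LogLipschitzOn K_S S s)
    (hσ : ∀ i, MapsTo (σ i) s s) (hσc : ∀ i, LipschitzOnWith c (σ i) s) (hK : (K_S + K) * c ≤ K)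
    (hg : LogLipschitzOn K g s) : LogLipschitzOn K (transfer σ S g) s :=
  LogLipschitzOn.sum Finset.univ_nonempty fun i _ => ((hS.mul hg).comp (hσc i) (hσ i)).mono hK

theorem LogLipschitzOn.transfer_pow [Nonempty ι] (hS : LogLipschitzOn K_S S s)
    (hσ : ∀ i, MapsTo (σ i) s s) (hσc : ∀ i, LipschitzOnWith c (σ i) s) (hK : (K_S + K) * c ≤ K)
    (hg : LogLipschitzOn K g s) (n : ℕ) :
    LogLipschitzOn K ((GenAffineFIF.transfer σ S ^ n) g) s := by
  induction n with
  | zero => exact hg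
  | succ n ih =>
    rw [pow_succ', Module.End.mul_apply]
    exact hS.transfer hσ hσc hK ih

theorem exists_transfer_pow_one_mem_Icc (hs : Bornology.IsBounded s) (hne : s.Nonempty)
    (hσ : ∀ i, MapsTo (σ i) s s) (hS : ∀ x ∈ s, 0 ≤ S x)
    (hT : ∀ n, LogLipschitzOn K ((transfer σ S ^ n) 1) s) :
    ∃ ρ a b : ℝ, 0 < ρ ∧ 0 < a ∧
      ∀ n, ∀ x ∈ s, (transfer σ S ^ n) 1 x ∈ Icc (a * ρ ^ n) (b * ρ ^ n) := by
  obtain ⟨x₀, hx₀⟩ := hne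
  set A : ℕ → α → ℝ := fun n => (transfer σ S ^ n) 1
  set E : ℝ := K * Metric.diam s
  have hdist (n : ℕ) : ∀ x ∈ s, A n x ∈ Icc (Real.exp (-E) * A n x₀) (Real.exp E * A n x₀) :=
    fun x hx => (hT n).mem_Icc_of_dist_le hx hx₀ (Metric.dist_le_diam_of_mem hs hx hx₀)
  have hadd (m n : ℕ) : A (m + n) x₀ ∈
      Icc (Real.exp (-E) * (A m x₀ * A n x₀)) (Real.exp E * (A m x₀ * A n x₀)) := by
    have hpow : A (m + n) = (transfer σ S ^ m) (A n) := by
      simp only [A, pow_add, Module.End.mul_apply]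
    have hsmul (e : ℝ) : e * (A m x₀ * A n x₀) = (transfer σ S ^ m) ((e * A n x₀) • 1) x₀ := by
      rw [map_smul, Pi.smul_apply, smul_eq_mul, mul_assoc, mul_comm (A m x₀)]
    rw [hpow, hsmul, hsmul]
    exact ⟨transfer_pow_mono hσ hS (fun x hx => by simpa using (hdist n x hx).1) m x₀ hx₀,
      transfer_pow_mono hσ hS (fun x hx => by simpa using (hdist n x hx).2) m x₀ hx₀⟩
  obtain ⟨ρ, hρ, hA⟩ := exists_mem_Icc_exp_mul_pow (fun n => (hT n).pos x₀ hx₀) hadd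
  refine ⟨ρ, Real.exp (-E) * Real.exp (-E), Real.exp E * Real.exp E, hρ, by positivity,
    fun n x hx => Icc_subset_Icc ?_ ?_ (hdist n x hx)⟩
  · rw [mul_assoc]
    gcongr
    exact (hA n).1
  · rw [mul_assoc]
    gcongr
    exact (hA n).2

/-- Every pointwise limit of the Cesàro means of `T ^ n 1` along an ultrafilter is fixed by `T`. -/
theorem exists_transfer_eq_self (hσ : ∀ i, MapsTo (σ i) s s)
    (hT : ∀ n, LogLipschitzOn K ((transfer σ S ^ n) 1) s) {a b : ℝ} (ha : 0 < a)
    (hab : ∀ n, ∀ x ∈ s, (transfer σ S ^ n) 1 x ∈ Icc a b) :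
    ∃ φ, LogLipschitzOn K φ s ∧ ∀ x ∈ s, transfer σ S φ x = φ x := by
  set T := transfer σ S
  let B (n : ℕ) : α → ℝ := (n + 1 : ℝ)⁻¹ • ∑ k ∈ Finset.range (n + 1), (T ^ k) 1
  have hBL (n : ℕ) : LogLipschitzOn K (B n) s := by
    simpa only [← Finset.sum_fn] using (LogLipschitzOn.sum Finset.nonempty_range_add_one
      fun k _ => hT k).const_smul (inv_pos.2 (n.cast_add_one_pos (α := ℝ)))
  have hBmem (n : ℕ) : ∀ x ∈ s, B n x ∈ Icc a b := fun x hx => by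
    simp only [B, Pi.smul_apply, Finset.sum_apply, Finset.smul_sum]
    refine (convex_Icc a b).sum_mem (fun _ _ => by positivity) ?_ fun k _ => hab k x hx
    rw [Finset.sum_const, Finset.card_range, nsmul_eq_mul, Nat.cast_succ]
    exact mul_inv_cancel₀ (by positivity)
  have hTB (n : ℕ) : ∀ x ∈ s, |T (B n) x - B n x| ≤ (b - a) / (n + 1) := fun x hx => by
    have htel : T (B n) - B n = (n + 1 : ℝ)⁻¹ • ((T ^ (n + 1)) 1 - (T ^ 0) 1) := by
      rw [map_smul, ← smul_sub, map_sum, ← Finset.sum_sub_distrib,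
        ← Finset.sum_range_sub fun k => (T ^ k) (1 : α → ℝ)]
      simp only [pow_succ', Module.End.mul_apply]
    rw [← Pi.sub_apply, htel, Pi.smul_apply, smul_eq_mul, ← div_eq_inv_mul, abs_div,
      abs_of_pos (n.cast_add_one_pos (α := ℝ))]
    gcongr
    exact abs_sub_le_of_le_of_le (hab _ x hx).1 (hab _ x hx).2 (hab 0 x hx).1 (hab 0 x hx).2
  have hlim : ∀ x, x ∈ s → ∃ l ∈ Icc a b, Tendsto (B · x) (hyperfilter ℕ) (𝓝 l) := fun x hx =>
    isCompact_Icc.ultrafilter_le_nhds ((hyperfilter ℕ).map (B · x))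
      (tendsto_principal.2 (Eventually.of_forall (hBmem · x hx)))
  choose! φ hφ hBφ using hlim
  refine ⟨φ, ⟨fun x hx => ha.trans_le (hφ x hx).1, fun x hx y hy =>
    le_of_tendsto_of_tendsto' (hBφ x hx) ((hBφ y hy).const_mul _)
      fun n => (hBL n).le_exp_mul x hx y hy⟩, fun x hx => ?_⟩
  have hTBφ : Tendsto (fun n => T (B n) x) (hyperfilter ℕ) (𝓝 (T φ x)) :=
    tendsto_finsetSum _ fun i _ => (hBφ _ (hσ i hx)).const_mul _
  have hzero : Tendsto (fun n => T (B n) x - B n x) (hyperfilter ℕ) (𝓝 0) := by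
    refine (squeeze_zero_norm (hTB · x hx) ?_).mono_left Nat.hyperfilter_le_atTop
    exact tendsto_const_nhds.div_atTop
      (tendsto_atTop_add_const_right _ _ tendsto_natCast_atTop_atTop)
  exact sub_eq_zero.1 (tendsto_nhds_unique (hTBφ.sub (hBφ x hx)) hzero)

theorem exists_eigenfunction [Nonempty ι] (hs : Bornology.IsBounded s) (hne : s.Nonempty)
    (hσ : ∀ i, MapsTo (σ i) s s) (hσc : ∀ i, LipschitzOnWith c (σ i) s) (hc : c < 1)
    (hS : LogLipschitzOn K_S S s) :
    ∃ ρ : ℝ, ∃ K φ, 0 < ρ ∧ LogLipschitzOn K φ s ∧ ∀ x ∈ s, transfer σ S φ x = ρ * φ x := by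
  have hK : (K_S + K_S * c / (1 - c)) * c ≤ K_S * c / (1 - c) := by
    have h1c : 0 < 1 - c := tsub_pos_of_lt hc
    refine le_of_eq ?_
    rw [eq_div_iff h1c.ne', mul_assoc, mul_comm c, ← mul_assoc, add_mul, div_mul_cancel₀ _ h1c.ne',
      ← mul_add, tsub_add_cancel_of_le hc.le, mul_one]
  have hT : ∀ n, LogLipschitzOn (K_S * c / (1 - c)) ((transfer σ S ^ n) 1) s :=
    hS.transfer_pow hσ hσc hK .one
  obtain ⟨ρ, a, b, hρ, ha, hab⟩ :=
    exists_transfer_pow_one_mem_Icc hs hne hσ (fun x hx => (hS.pos x hx).le) hT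
  have hpow (n : ℕ) :
      (transfer σ (ρ⁻¹ • S) ^ n) 1 = (ρ ^ n)⁻¹ • (transfer σ S ^ n) (1 : α → ℝ) := by
    rw [transfer_smul_weight, smul_pow, LinearMap.smul_apply, inv_pow]
  obtain ⟨φ, hφ, hφfix⟩ := exists_transfer_eq_self (S := ρ⁻¹ • S) hσ
    (fun n => hpow n ▸ (hT n).const_smul (by positivity)) ha
    fun n x hx => by
      rw [hpow, Pi.smul_apply, smul_eq_mul, ← div_eq_inv_mul, mem_Icc, le_div_iff₀ (by positivity),
        div_le_iff₀ (by positivity)]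
      exact hab n x hx
  refine ⟨ρ, _, φ, hρ, hφ, fun x hx => ?_⟩
  have := hφfix x hx
  rwa [transfer_smul_weight, LinearMap.smul_apply, Pi.smul_apply, smul_eq_mul,
    inv_mul_eq_iff_eq_mul₀ hρ.ne'] at this

end Transfer

/-! ### Spectral radii of nonnegative matrices -/

section SpectralRadius

variable {n : ℕ} {A : Matrix (Fin n) (Fin n) ℝ} {v : Fin n → ℝ} {r : ℝ}

theorem specRadius_le_of_vecMul_le (hA : ∀ i j, 0 ≤ A i j) (hv : ∀ i, 0 < v i) (hr : 0 ≤ r)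
    (h : v ᵥ* A ≤ r • v) : specRadius A ≤ r := by
  refine ENNReal.toReal_le_of_le_ofReal hr (iSup₂_le fun μ hμ => ?_)
  rw [← enorm_eq_nnnorm, ← ofReal_norm]
  refine ENNReal.ofReal_le_ofReal ?_
  rw [← Matrix.spectrum_toLin'] at hμ
  obtain ⟨u, hu⟩ := (Module.End.HasEigenvalue.of_mem_spectrum hμ).exists_hasEigenvector
  let w : Fin n → ℝ := fun i => ‖u i‖
  have hw : 0 ≤ w := fun i => norm_nonneg _
  have hvw : 0 < v ⬝ᵥ w := by
    obtain ⟨i, hi⟩ := Function.ne_iff.1 hu.2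
    exact Finset.sum_pos' (fun j _ => mul_nonneg (hv j).le (hw j))
      ⟨i, Finset.mem_univ i, mul_pos (hv i) (norm_pos_iff.2 hi)⟩
  have hμw : ‖μ‖ • w ≤ A *ᵥ w := fun i => by
    calc ‖μ‖ * ‖u i‖ = ‖∑ j, (A i j : ℂ) * u j‖ := by
          rw [← norm_mul]
          exact congrArg norm (congrFun hu.apply_eq_smul i).symm
      _ ≤ ∑ j, ‖(A i j : ℂ) * u j‖ := norm_sum_le _ _
      _ = ∑ j, A i j * ‖u j‖ := by simp only [norm_mul, Complex.norm_of_nonneg (hA i _)]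
  refine le_of_mul_le_mul_right ?_ hvw
  calc ‖μ‖ * (v ⬝ᵥ w) = v ⬝ᵥ (‖μ‖ • w) := by rw [dotProduct_smul, smul_eq_mul]
    _ ≤ v ⬝ᵥ (A *ᵥ w) := dotProduct_le_dotProduct_of_nonneg_left hμw fun i => (hv i).le
    _ = (v ᵥ* A) ⬝ᵥ w := dotProduct_mulVec _ _ _
    _ ≤ (r • v) ⬝ᵥ w := dotProduct_le_dotProduct_of_nonneg_right h hw
    _ = r * (v ⬝ᵥ w) := by rw [smul_dotProduct, smul_eq_mul]

theorem pow_smul_le_vecMul_pow (hA : ∀ i j, 0 ≤ A i j) (hr : 0 ≤ r) (h : r • v ≤ v ᵥ* A) (m : ℕ) :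
    r ^ m • v ≤ v ᵥ* A ^ m := by
  induction m with
  | zero => simp
  | succ m ih =>
    calc r ^ (m + 1) • v = r ^ m • (r • v) := by rw [pow_succ, mul_smul]
      _ ≤ r ^ m • (v ᵥ* A) := smul_le_smul_of_nonneg_left h (pow_nonneg hr m)
      _ = (r ^ m • v) ᵥ* A := (smul_vecMul _ _ _).symm
      _ ≤ (v ᵥ* A ^ m) ᵥ* A :=
        fun j => dotProduct_le_dotProduct_of_nonneg_right ih fun i => hA i j
      _ = v ᵥ* A ^ (m + 1) := by rw [vecMul_vecMul, pow_succ]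

attribute [local instance] Matrix.linftyOpNormedRing Matrix.linftyOpNormedAlgebra

theorem pow_le_norm_map_pow (hA : ∀ i j, 0 ≤ A i j) (hv : 0 < v) (hr : 0 ≤ r)
    (h : r • v ≤ v ᵥ* A) (m : ℕ) : r ^ m ≤ ‖(A.map (fun a : ℝ => (a : ℂ))) ^ m‖ := by
  set B := A.map (fun a : ℝ => (a : ℂ))
  have hpow : B ^ m = (A ^ m).map (fun a : ℝ => (a : ℂ)) :=
    (map_pow (Complex.ofRealHom.mapMatrix (m := Fin n)) A m).symm
  have hrow : A ^ m *ᵥ 1 ≤ ‖B ^ m‖ • 1 := fun i => by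
    have hi : (B ^ m *ᵥ 1) i = (((A ^ m *ᵥ 1) i : ℝ) : ℂ) := by
      simp [hpow, mulVec, dotProduct]
    calc (A ^ m *ᵥ 1) i ≤ ‖(B ^ m *ᵥ 1) i‖ := by
          rw [hi, Complex.norm_real]
          exact le_abs_self _
      _ ≤ ‖B ^ m *ᵥ 1‖ := norm_le_pi_norm _ i
      _ ≤ ‖B ^ m‖ * ‖(1 : Fin n → ℂ)‖ := linfty_opNorm_mulVec _ _
      _ ≤ ‖B ^ m‖ * 1 := by
          gcongr
          exact (pi_norm_le_iff_of_nonneg zero_le_one).2 fun _ => norm_one.le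
  have hv1 : 0 < v ⬝ᵥ 1 := by
    rw [dotProduct_one]
    exact Finset.sum_pos' (fun i _ => hv.le i) (by simpa using (Pi.lt_def.1 hv).2)
  refine le_of_mul_le_mul_right ?_ hv1
  calc r ^ m * (v ⬝ᵥ 1) = (r ^ m • v) ⬝ᵥ 1 := by rw [smul_dotProduct, smul_eq_mul]
    _ ≤ (v ᵥ* A ^ m) ⬝ᵥ 1 :=
      dotProduct_le_dotProduct_of_nonneg_right (pow_smul_le_vecMul_pow hA hr h m) zero_le_one
    _ = v ⬝ᵥ (A ^ m *ᵥ 1) := (dotProduct_mulVec _ _ _).symm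
    _ ≤ v ⬝ᵥ (‖B ^ m‖ • 1) := dotProduct_le_dotProduct_of_nonneg_left hrow hv.le
    _ = ‖B ^ m‖ * (v ⬝ᵥ 1) := by rw [dotProduct_smul, smul_eq_mul]

theorem le_specRadius_of_le_vecMul (hA : ∀ i j, 0 ≤ A i j) (hv : 0 < v) (hr : 0 ≤ r)
    (h : r • v ≤ v ᵥ* A) : r ≤ specRadius A := by
  set B := A.map (fun a : ℝ => (a : ℂ))
  obtain ⟨i, -⟩ := Function.ne_iff.1 hv.ne'
  have : Nonempty (Fin n) := ⟨i⟩
  have hfin : spectralRadius ℂ B ≠ ⊤ :=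
    ((spectrum.spectralRadius_le_nnnorm (𝕜 := ℂ) B).trans_lt ENNReal.coe_lt_top).ne
  refine (ENNReal.ofReal_le_iff_le_toReal hfin).1
    (ge_of_tendsto (spectrum.pow_norm_pow_one_div_tendsto_nhds_spectralRadius B) ?_)
  filter_upwards [eventually_ne_atTop 0] with m hm
  refine ENNReal.ofReal_le_ofReal ?_
  rw [one_div, Real.le_rpow_inv_iff_of_pos hr (norm_nonneg _) (by positivity), Real.rpow_natCast]
  exact pow_le_norm_map_pow hA hv hr h m

end SpectralRadius

/-! ### The grid of mesh `N⁻ᵏ` -/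

section Grid

variable {N k j : ℕ} {s t : ℝ}

/-- The map `L_i` for the uniform nodes of `[0, 1]`, that is, the `i`-th inverse branch of
`t ↦ N * t` modulo `1`. -/
noncomputable def branch (i : Fin N) (t : ℝ) : ℝ := (t + (i : ℕ)) / N

/-- The left end point of `subInterval N 0 1 k j`. -/
noncomputable def gridPoint (N k j : ℕ) : ℝ := j / (N : ℝ) ^ k

theorem nodeMap_unifNodes (i : Fin N) : nodeMap (unifNodes N) i = branch i := by
  have hN : (N : ℝ) ≠ 0 := Nat.cast_ne_zero.2 i.pos.ne'
  ext t
  simp only [nodeMap, chord, branch, unifNodes, Fin.val_castSucc, Fin.val_succ, Fin.val_zero,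
    Fin.val_last, Nat.cast_add, Nat.cast_one, Nat.cast_zero]
  field_simp
  ring

theorem mapsTo_branch (i : Fin N) : MapsTo (branch i) (Icc 0 1) (Icc 0 1) := fun t ht => by
  have hN : (0 : ℝ) < N := Nat.cast_pos.2 i.pos
  have hi : ((i : ℕ) : ℝ) + 1 ≤ N := by exact_mod_cast i.isLt
  rw [branch, mem_Icc, div_le_one hN]
  exact ⟨div_nonneg (by linarith [ht.1, (i : ℕ).cast_nonneg (α := ℝ)]) hN.le, by linarith [ht.2]⟩

theorem branch_sub_branch (i : Fin N) (s t : ℝ) : branch i s - branch i t = (s - t) / N := by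
  rw [branch, branch]; ring

theorem lipschitzWith_branch (i : Fin N) : LipschitzWith (N : ℝ≥0)⁻¹ (branch i) :=
  LipschitzWith.of_dist_le_mul fun s t => by
    rw [Real.dist_eq, branch_sub_branch, abs_div, Nat.abs_cast, Real.dist_eq, div_eq_inv_mul,
      NNReal.coe_inv, NNReal.coe_natCast]

theorem LogLipschitzOn.comp_branch {K : ℝ≥0} {g : ℝ → ℝ} (hg : LogLipschitzOn K g (Icc 0 1))
    (i : Fin N) : LogLipschitzOn K (g ∘ branch i) (Icc 0 1) :=
  (hg.comp (lipschitzWith_branch i).lipschitzOnWith (mapsTo_branch i)).mono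
    (mul_le_of_le_one_right' (inv_le_one_of_one_le₀ (Nat.one_le_cast.2 i.pos)))

theorem branch_gridPoint (i : Fin N) (k j : ℕ) :
    branch i (gridPoint N k j) = gridPoint N (k + 1) (i * N ^ k + j) := by
  have hN : (N : ℝ) ≠ 0 := Nat.cast_ne_zero.2 i.pos.ne'
  rw [branch, gridPoint, gridPoint]
  push_cast
  field_simp
  ring

theorem subInterval_eq_Icc (N k j : ℕ) :
    subInterval N 0 1 k j = Icc (gridPoint N k j) (gridPoint N k (j + 1)) := by
  simp [subInterval, gridPoint]

theorem image_branch_subInterval (i : Fin N) (k j : ℕ) :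
    branch i '' subInterval N 0 1 k j = subInterval N 0 1 (k + 1) (i * N ^ k + j) := by
  have hN : (0 : ℝ) < N := Nat.cast_pos.2 i.pos
  have haff : branch i = fun t => (N : ℝ)⁻¹ * t + ((i : ℕ) : ℝ) / N := by
    ext t; rw [branch]; ring
  have himage (a b : ℝ) : branch i '' Icc a b = Icc (branch i a) (branch i b) := by
    rw [haff, image_affine_Icc' (inv_pos.2 hN)]
  rw [subInterval_eq_Icc, himage, branch_gridPoint, branch_gridPoint, subInterval_eq_Icc, add_assoc]

theorem cell_eq_subInterval (i : Fin N) (k j : ℕ) :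
    cell N k i j = subInterval N 0 1 (k + 1) (i * N ^ k + j) := by
  have hN : (N : ℝ) ≠ 0 := Nat.cast_ne_zero.2 i.pos.ne'
  rw [cell, subInterval, subInterval]
  congr 1 <;> (push_cast; field_simp; ring)

theorem child_lt {i : Fin N} (hj : j < N ^ k) : i * N ^ k + j < N ^ (k + 1) := by
  calc i * N ^ k + j < (i + 1) * N ^ k := by rw [add_one_mul]; lia
    _ ≤ N * N ^ k := Nat.mul_le_mul_right _ i.isLt
    _ = N ^ (k + 1) := (pow_succ' N k).symm

theorem sum_range_pow_succ (N k : ℕ) (F : ℕ → ℝ) :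
    ∑ j ∈ Finset.range (N ^ (k + 1)), F j =
      ∑ i : Fin N, ∑ j ∈ Finset.range (N ^ k), F (i * N ^ k + j) := by
  simp only [pow_succ', Finset.sum_range, ← Fintype.sum_prod_type']
  exact (finProdFinEquiv.sum_comp fun x => F x).symm.trans
    (Finset.sum_congr rfl fun x _ => congrArg F (by simp [finProdFinEquiv]; ring))

theorem gridPoint_le_succ (N k j : ℕ) : gridPoint N k j ≤ gridPoint N k (j + 1) := by
  rw [gridPoint, gridPoint]
  gcongr
  exact j.le_succ

theorem left_mem_subInterval (N k j : ℕ) : gridPoint N k j ∈ subInterval N 0 1 k j := by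
  rw [subInterval_eq_Icc]
  exact left_mem_Icc.2 (gridPoint_le_succ N k j)

theorem subInterval_subset (hj : j < N ^ k) : subInterval N 0 1 k j ⊆ Icc 0 1 := by
  rw [subInterval_eq_Icc]
  refine Icc_subset_Icc (div_nonneg j.cast_nonneg (by positivity)) (div_le_one_of_le₀ ?_ ?_)
  · exact_mod_cast hj
  · positivity

theorem gridPoint_mem_Icc (hj : j < N ^ k) : gridPoint N k j ∈ Icc 0 1 :=
  subInterval_subset hj (left_mem_subInterval N k j)

theorem dist_le_of_mem_subInterval (hs : s ∈ subInterval N 0 1 k j)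
    (ht : t ∈ subInterval N 0 1 k j) : dist s t ≤ 1 / (N : ℝ) ^ k := by
  rw [subInterval_eq_Icc] at hs ht
  refine (Real.dist_le_of_mem_Icc hs ht).trans_eq ?_
  rw [gridPoint, gridPoint, Nat.cast_succ]
  ring

theorem exists_mem_subInterval (hN : 0 < N) (k : ℕ) (ht : t ∈ Icc 0 1) :
    ∃ j < N ^ k, t ∈ subInterval N 0 1 k j := by
  have hNk : 0 < N ^ k := by positivity
  have hNk' : (0 : ℝ) < (N : ℝ) ^ k := by exact_mod_cast hNk
  have hceil : ⌈t * N ^ k⌉₊ ≤ N ^ k := by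
    rw [Nat.ceil_le, Nat.cast_pow]
    exact mul_le_of_le_one_left hNk'.le ht.2
  refine ⟨⌈t * N ^ k⌉₊ - 1, by lia, ?_⟩
  rw [subInterval_eq_Icc, gridPoint, gridPoint, mem_Icc, div_le_iff₀ hNk', le_div_iff₀ hNk']
  constructor
  · rcases Nat.eq_zero_or_pos ⌈t * N ^ k⌉₊ with h | h
    · simpa [h] using mul_nonneg ht.1 hNk'.le
    · exact (Nat.lt_ceil.1 (Nat.sub_one_lt_of_lt h)).le
  · exact (Nat.le_ceil _).trans (Nat.cast_le.2 (by lia))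

theorem gridPoint_succ_mem_subInterval (hN : 0 < N) (k j : ℕ) :
    gridPoint N (k + 1) j ∈ subInterval N 0 1 k (j / N) := by
  have hscale (m : ℕ) : gridPoint N k m = gridPoint N (k + 1) (m * N) := by
    rw [gridPoint, gridPoint, pow_succ, Nat.cast_mul, mul_div_mul_right _ _ (by positivity)]
  rw [subInterval_eq_Icc, hscale, hscale, mem_Icc, gridPoint, gridPoint, gridPoint]
  constructor <;> gcongr
  · exact Nat.div_mul_le_self j N
  · exact (Nat.lt_mul_of_div_lt (Nat.lt_succ_self _) hN).le

end Grid

/-! ### Spectral radii of the vertical scaling matrices -/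

section ScaleMatrix

variable {N k : ℕ} {S φ : ℝ → ℝ} {K K_S : ℝ≥0} {s : ℕ → ℕ → ℝ} {ρ : ℝ}

theorem vecMul_scaleMatrix (hN : 0 < N) (k : ℕ) (s : ℕ → ℕ → ℝ) (g : ℕ → ℝ)
    (j : Fin (N ^ (k + 1))) :
    ((fun r : Fin (N ^ (k + 1)) => g r) ᵥ* scaleMatrix N (k + 1) s) j =
      ∑ i : Fin N, g (i * N ^ k + j / N) * s i j := by
  have hjN : (j : ℕ) / N < N ^ k := Nat.div_lt_of_lt_mul (by rw [← pow_succ']; exact j.isLt)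
  have hrow (l : ℕ) : (l * N ≤ (j : ℕ) ∧ (j : ℕ) < (l + 1) * N) ↔ l = j / N := by
    rw [← Nat.le_div_iff_mul_le hN, ← Nat.div_lt_iff_lt_mul hN]
    lia
  let entry (r : ℕ) : ℝ := if r % N ^ k = j / N then s (r / N ^ k) j else 0
  calc ((fun r : Fin (N ^ (k + 1)) => g r) ᵥ* scaleMatrix N (k + 1) s) j
      = ∑ r : Fin (N ^ (k + 1)), g r * entry r := by
        simp only [vecMul, dotProduct, scaleMatrix, of_apply, add_tsub_cancel_right, hrow, entry]
    _ = ∑ i : Fin N, ∑ l ∈ Finset.range (N ^ k), g (i * N ^ k + l) * entry (i * N ^ k + l) := by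
        rw [Fin.sum_univ_eq_sum_range fun r => g r * entry r, sum_range_pow_succ]
    _ = ∑ i : Fin N, g (i * N ^ k + j / N) * s i j := by
        refine Finset.sum_congr rfl fun i _ => ?_
        have hentry {l : ℕ} (hl : l < N ^ k) :
            entry (i * N ^ k + l) = if l = j / N then s i j else 0 := by
          have hdiv : (i * N ^ k + l) / N ^ k = i := by
            rw [mul_comm, Nat.mul_add_div (by positivity), Nat.div_eq_of_lt hl, add_zero]
          simp only [entry, Nat.mul_add_mod_self_right, Nat.mod_eq_of_lt hl, hdiv]
        rw [Finset.sum_eq_single_of_mem _ (Finset.mem_range.2 hjN) fun l hl hne => by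
          rw [hentry (Finset.mem_range.1 hl), if_neg hne, mul_zero], hentry hjN, if_pos rfl]

/-- The entries `s` of a vertical scaling matrix of level `k` agree with the values of `S` at the
left end points of the cells, up to a factor `exp (± K / N ^ k)`. -/
def IsScaleApprox (S : ℝ → ℝ) (K : ℝ≥0) (N k : ℕ) (s : ℕ → ℕ → ℝ) : Prop :=
  ∀ i : Fin N, ∀ j < N ^ k, s i j ∈
    Icc (Real.exp (-(K * (1 / (N : ℝ) ^ k))) * S (branch i (gridPoint N k j)))
      (Real.exp (K * (1 / (N : ℝ) ^ k)) * S (branch i (gridPoint N k j)))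

theorem image_abs_cell_subset (hS : LogLipschitzOn K S (Icc 0 1)) (i : Fin N) {j : ℕ}
    (hj : j < N ^ k) : (fun x => |S x|) '' cell N k i j ⊆
    Icc (Real.exp (-(K * (1 / (N : ℝ) ^ k))) * S (branch i (gridPoint N k j)))
      (Real.exp (K * (1 / (N : ℝ) ^ k)) * S (branch i (gridPoint N k j))) := by
  rw [cell_eq_subInterval, ← image_branch_subInterval, image_image]
  rintro _ ⟨t, ht, rfl⟩
  have htI := subInterval_subset hj ht
  beta_reduce
  rw [abs_of_pos (hS.pos _ (mapsTo_branch i htI))]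
  exact (hS.comp_branch i).mem_Icc_of_dist_le htI (gridPoint_mem_Icc hj)
    (dist_le_of_mem_subInterval ht (left_mem_subInterval N k j))

theorem cell_nonempty (i : Fin N) (k j : ℕ) : (cell N k i j).Nonempty :=
  cell_eq_subInterval i k j ▸ ⟨_, left_mem_subInterval N _ _⟩

theorem isScaleApprox_upperScale (hS : LogLipschitzOn K S (Icc 0 1)) :
    IsScaleApprox S K N k (upperScale N S k) := fun i j hj =>
  have hsub := image_abs_cell_subset hS i hj
  closure_minimal hsub isClosed_Icc
    (csSup_mem_closure ((cell_nonempty i k j).image _) (bddAbove_Icc.mono hsub))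

theorem isScaleApprox_lowerScale (hS : LogLipschitzOn K S (Icc 0 1)) :
    IsScaleApprox S K N k (lowerScale N S k) := fun i j hj =>
  have hsub := image_abs_cell_subset hS i hj
  closure_minimal hsub isClosed_Icc
    (csInf_mem_closure ((cell_nonempty i k j).image _) (bddBelow_Icc.mono hsub))

theorem IsScaleApprox.scaleMatrix_nonneg (hs : IsScaleApprox S K N (k + 1) s)
    (hS : ∀ x ∈ Icc 0 1, 0 ≤ S x) (r j : Fin (N ^ (k + 1))) :
    0 ≤ scaleMatrix N (k + 1) s r j := by
  have hi : (r : ℕ) / N ^ k < N := Nat.div_lt_of_lt_mul (by rw [← pow_succ]; exact r.isLt)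
  have hentry : 0 ≤ s (r / N ^ k) j :=
    (mul_nonneg (Real.exp_nonneg _)
      (hS _ (mapsTo_branch ⟨_, hi⟩ (gridPoint_mem_Icc j.isLt)))).trans (hs ⟨_, hi⟩ j j.isLt).1
  rw [scaleMatrix, of_apply, add_tsub_cancel_right]
  split_ifs
  exacts [hentry, le_rfl]

theorem IsScaleApprox.gridPoint_mul_mem_Icc (hs : IsScaleApprox S K_S N (k + 1) s) (hN : 0 < N)
    (hS : ∀ x ∈ Icc 0 1, 0 ≤ S x) (hφ : LogLipschitzOn K φ (Icc 0 1)) (i : Fin N) {j : ℕ}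
    (hj : j < N ^ (k + 1)) :
    φ (gridPoint N (k + 1) (i * N ^ k + j / N)) * s i j ∈
      Icc (Real.exp (-((K + K_S) / (N : ℝ) ^ k)) *
          ((φ * S) (branch i (gridPoint N (k + 1) j))))
        (Real.exp ((K + K_S) / (N : ℝ) ^ k) * ((φ * S) (branch i (gridPoint N (k + 1) j)))) := by
  have hjN : j / N < N ^ k := Nat.div_lt_of_lt_mul (by rwa [← pow_succ'])
  have hx := gridPoint_mem_Icc hj
  obtain ⟨hs_low, hs_up⟩ := hs i j hj
  obtain ⟨hφ_low, hφ_up⟩ := (hφ.comp_branch i).mem_Icc_of_dist_le (gridPoint_mem_Icc hjN) hx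
    (dist_le_of_mem_subInterval (left_mem_subInterval N k (j / N))
      (gridPoint_succ_mem_subInterval hN k j))
  simp only [Function.comp_apply, branch_gridPoint i k] at hφ_low hφ_up
  have hSx := hS _ (mapsTo_branch i hx)
  have hφx := hφ.pos _ (mapsTo_branch i hx)
  have hφr := hφ.pos _ (gridPoint_mem_Icc (child_lt (i := i) hjN))
  have hpow : (1 : ℝ) / N ^ (k + 1) ≤ 1 / N ^ k := by
    gcongr
    exacts [Nat.one_le_cast.2 hN, k.le_succ]
  have hsplit : (K + K_S) / (N : ℝ) ^ k = K * (1 / N ^ k) + K_S * (1 / N ^ k) := by ring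
  rw [hsplit, neg_add, Real.exp_add, Real.exp_add, Pi.mul_apply]
  constructor
  · rw [mul_mul_mul_comm]
    refine mul_le_mul hφ_low (le_trans ?_ hs_low) (by positivity) hφr.le
    gcongr
  · rw [mul_mul_mul_comm]
    refine mul_le_mul hφ_up (hs_up.trans ?_) ?_ (by positivity)
    · gcongr
    · exact (mul_nonneg (Real.exp_nonneg _) hSx).trans hs_low

/-- The rows of `scaleMatrix` that meet column `j` correspond to the preimages of the cell
containing the `j`-th grid point, so that `v ↦ v ᵥ* M_k` is a discretized transfer operator. -/
theorem vecMul_scaleMatrix_mem_Icc (hN : 0 < N) (hS : ∀ x ∈ Icc 0 1, 0 ≤ S x)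
    (hφ : LogLipschitzOn K φ (Icc 0 1))
    (hρ : ∀ x ∈ Icc 0 1, transfer (branch (N := N)) S φ x = ρ * φ x)
    (hs : IsScaleApprox S K_S N (k + 1) s) (j : Fin (N ^ (k + 1))) :
    ((fun r : Fin (N ^ (k + 1)) => φ (gridPoint N (k + 1) r)) ᵥ* scaleMatrix N (k + 1) s) j ∈
      Icc (Real.exp (-((K + K_S) / (N : ℝ) ^ k)) * ρ * φ (gridPoint N (k + 1) j))
        (Real.exp ((K + K_S) / (N : ℝ) ^ k) * ρ * φ (gridPoint N (k + 1) j)) := by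
  have hsum : ρ * φ (gridPoint N (k + 1) j) =
      ∑ i : Fin N, (φ * S) (branch i (gridPoint N (k + 1) j)) := by
    rw [← hρ _ (gridPoint_mem_Icc j.isLt), transfer_apply]
    simp only [Pi.mul_apply, mul_comm]
  have hterm (i : Fin N) := hs.gridPoint_mul_mem_Icc hN hS hφ i j.isLt
  rw [vecMul_scaleMatrix hN k s fun r => φ (gridPoint N (k + 1) r), mul_assoc, mul_assoc, hsum,
    Finset.mul_sum, Finset.mul_sum]
  exact ⟨Finset.sum_le_sum fun i _ => (hterm i).1, Finset.sum_le_sum fun i _ => (hterm i).2⟩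

theorem specRadius_scaleMatrix_mem_Icc (hN : 0 < N) (hS : ∀ x ∈ Icc 0 1, 0 ≤ S x)
    (hφ : LogLipschitzOn K φ (Icc 0 1)) (hρ0 : 0 ≤ ρ)
    (hρ : ∀ x ∈ Icc 0 1, transfer (branch (N := N)) S φ x = ρ * φ x)
    (hs : IsScaleApprox S K_S N (k + 1) s) :
    specRadius (scaleMatrix N (k + 1) s) ∈
      Icc (Real.exp (-((K + K_S) / (N : ℝ) ^ k)) * ρ) (Real.exp ((K + K_S) / (N : ℝ) ^ k) * ρ) := by
  have hpos (r : Fin (N ^ (k + 1))) : 0 < φ (gridPoint N (k + 1) r) :=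
    hφ.pos _ (gridPoint_mem_Icc r.isLt)
  have hvec := vecMul_scaleMatrix_mem_Icc hN hS hφ hρ hs
  exact ⟨le_specRadius_of_le_vecMul (hs.scaleMatrix_nonneg hS)
      (Pi.lt_def.2 ⟨fun r => (hpos r).le, ⟨0, by positivity⟩, hpos _⟩) (by positivity)
      fun j => (hvec j).1,
    specRadius_le_of_vecMul_le (hs.scaleMatrix_nonneg hS) hpos (by positivity)
      fun j => (hvec j).2⟩

theorem tendsto_specRadius_scaleMatrix (hN : 2 ≤ N) (hS : ∀ x ∈ Icc 0 1, 0 ≤ S x)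
    (hφ : LogLipschitzOn K φ (Icc 0 1)) (hρ0 : 0 ≤ ρ)
    (hρ : ∀ x ∈ Icc 0 1, transfer (branch (N := N)) S φ x = ρ * φ x) {s : ℕ → ℕ → ℕ → ℝ}
    (hs : ∀ k, IsScaleApprox S K_S N k (s k)) :
    Tendsto (fun k => specRadius (scaleMatrix N k (s k))) atTop (𝓝 ρ) := by
  have hzero : Tendsto (fun k => (K + K_S) / (N : ℝ) ^ k) atTop (𝓝 0) :=
    tendsto_const_nhds.div_atTop
      (tendsto_pow_atTop_atTop_of_one_lt (by exact_mod_cast hN))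
  have hmem (k : ℕ) := specRadius_scaleMatrix_mem_Icc (by lia) hS hφ hρ0 hρ (hs (k + 1))
  refine (tendsto_add_atTop_iff_nat 1).1 (tendsto_of_tendsto_of_tendsto_of_le_of_le ?_ ?_
    (fun k => (hmem k).1) fun k => (hmem k).2)
  · simpa using hzero.neg.rexp.mul_const ρ
  · simpa using hzero.rexp.mul_const ρ

theorem isRhoS_of_transfer_eq_mul (hN : 2 ≤ N) (hS : LogLipschitzOn K_S S (Icc 0 1))
    (hφ : LogLipschitzOn K φ (Icc 0 1)) (hρ0 : 0 ≤ ρ)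
    (hρ : ∀ x ∈ Icc 0 1, transfer (branch (N := N)) S φ x = ρ * φ x) : IsRhoS N S ρ :=
  have hS0 : ∀ x ∈ Icc 0 1, 0 ≤ S x := fun x hx => (hS.pos x hx).le
  ⟨tendsto_specRadius_scaleMatrix hN hS0 hφ hρ0 hρ fun _ => isScaleApprox_upperScale hS,
    tendsto_specRadius_scaleMatrix hN hS0 hφ hρ0 hρ fun _ => isScaleApprox_lowerScale hS⟩

end ScaleMatrix

/-! ### The functional equation -/

section SelfAffine

variable {N : ℕ} {S f : ℝ → ℝ}

/-- The functional equation of an affine fractal interpolation function on `[0, 1]`, with intercepts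
`a` and slopes `d` on the cells of the first level. -/
def SelfAffine (S f : ℝ → ℝ) (a d : Fin N → ℝ) : Prop :=
  ∀ i, ∀ t ∈ Icc 0 1, f (branch i t) = S (branch i t) * f t + (a i + d i * t)

theorem strictMono_unifNodes (hN : 0 < N) : StrictMono (unifNodes N) := fun _ _ hij =>
  div_lt_div_of_pos_right (Nat.cast_lt.2 hij) (Nat.cast_pos.2 hN)

theorem unifNodes_last (hN : 0 < N) : unifNodes N (Fin.last N) = 1 :=
  div_self (Nat.cast_ne_zero.2 hN.ne')

theorem unifNodes_zero (N : ℕ) : unifNodes N 0 = 0 := by simp [unifNodes]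

theorem polyline_branch (y : Fin (N + 1) → ℝ) (i : Fin N) {t : ℝ} (ht : t ∈ Icc 0 1) :
    polyline (unifNodes N) y (branch i t) = y i.castSucc + (y i.succ - y i.castSucc) * t := by
  have hN : (0 : ℝ) < N := Nat.cast_pos.2 i.pos
  have hmem : branch i t ∈ Icc (unifNodes N i.castSucc) (unifNodes N i.succ) := by
    simp only [unifNodes, branch, Fin.val_succ, Fin.val_castSucc, Nat.cast_succ, mem_Icc]
    exact ⟨div_le_div_of_nonneg_right (by linarith [ht.1]) hN.le,
      div_le_div_of_nonneg_right (by linarith [ht.2]) hN.le⟩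
  rw [polyline_eq_chord (strictMono_unifNodes i.pos) y i hmem]
  simp only [chord, unifNodes, branch, Fin.val_succ, Fin.val_castSucc, Nat.cast_succ]
  field_simp
  ring

theorem IsGenAffineFIF.continuousOn_Icc {y : Fin (N + 1) → ℝ} (hN : 0 < N)
    (hf : IsGenAffineFIF (unifNodes N) y S f) : ContinuousOn f (Icc 0 1) := by
  simpa only [unifNodes_zero, unifNodes_last hN] using hf.continuousOn

theorem IsGenAffineFIF.selfAffine {y : Fin (N + 1) → ℝ} (hN : 0 < N) (hy0 : y 0 = 0)
    (hyN : y (Fin.last N) = 0) (hf : IsGenAffineFIF (unifNodes N) y S f) :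
    SelfAffine S f (fun i => y i.castSucc) fun i => y i.succ - y i.castSucc := fun i t ht => by
  have hinv := hf.invariant
  rw [unifNodes_zero, unifNodes_last hN] at hinv
  have hbase : baseLine (unifNodes N) y t = 0 := by simp [baseLine, chord, hy0, hyN]
  obtain ⟨u, -, hu⟩ : ifsMap (unifNodes N) y S i (t, f t) ∈ graphOver f 0 1 :=
    hinv ▸ mem_iUnion_of_mem i (mem_image_of_mem _ ⟨t, ht, rfl⟩)
  simp only [ifsMap, vertMap, nodeMap_unifNodes, Prod.mk.injEq] at hu
  obtain ⟨rfl, hu⟩ := hu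
  rw [hu, hbase, sub_zero, polyline_branch y i ht]

theorem sum_slopes_eq_zero {y : Fin (N + 1) → ℝ} (hy0 : y 0 = 0) (hyN : y (Fin.last N) = 0) :
    ∑ i : Fin N, (y i.succ - y i.castSucc) = 0 := by
  have htel := (Fin.sum_univ_succ y).symm.trans (Fin.sum_univ_castSucc y)
  rw [hy0, hyN, zero_add, add_zero] at htel
  rw [Finset.sum_sub_distrib, htel, sub_self]

theorem gammaMin_le (hS : ∀ t ∈ Icc 0 1, 0 ≤ S t) {t : ℝ} (ht : t ∈ Icc 0 1) :
    gammaMin N S ≤ ∑ i : Fin N, S (branch i t) := by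
  have hbdd : BddBelow (sumFun N S '' Icc 0 1) :=
    ⟨0, forall_mem_image.2 fun s _ => Finset.sum_nonneg fun _ _ => abs_nonneg _⟩
  refine (csInf_le hbdd (mem_image_of_mem _ ht)).trans_eq (Finset.sum_congr rfl fun i _ => ?_)
  rw [nodeMap_unifNodes, abs_of_nonneg (hS _ (mapsTo_branch i ht))]

end SelfAffine

/-! ### Oscillations -/

section Osc

variable {f g : ℝ → ℝ} {U : Set ℝ} {s t : ℝ}

theorem abs_sub_le_osc (hU : IsCompact U) (hg : ContinuousOn g U) (hs : s ∈ U) (ht : t ∈ U) :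
    |g s - g t| ≤ osc g U := by
  obtain ⟨C, hC⟩ := hU.exists_bound_of_continuousOn hg
  refine le_csSup ⟨C + C, ?_⟩ ⟨s, hs, t, ht, rfl⟩
  rintro _ ⟨s, hs, t, ht, rfl⟩
  exact (abs_sub _ _).trans (add_le_add (hC s hs) (hC t ht))

theorem osc_le (hne : U.Nonempty) {c : ℝ} (h : ∀ s ∈ U, ∀ t ∈ U, |g s - g t| ≤ c) :
    osc g U ≤ c := by
  obtain ⟨u, hu⟩ := hne
  refine csSup_le ⟨_, u, hu, u, hu, rfl⟩ ?_
  rintro _ ⟨s, hs, t, ht, rfl⟩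
  exact h s hs t ht

theorem osc_nonneg (g : ℝ → ℝ) (U : Set ℝ) : 0 ≤ osc g U :=
  Real.sSup_nonneg (by rintro _ ⟨s, _, t, _, rfl⟩; exact abs_nonneg _)

theorem osc_image (g σ : ℝ → ℝ) (U : Set ℝ) : osc g (σ '' U) = osc (g ∘ σ) U := by
  simp only [osc, exists_mem_image, Function.comp_apply]

theorem exists_osc_eq (hU : IsCompact U) (hne : U.Nonempty) (hg : ContinuousOn g U) :
    ∃ s ∈ U, ∃ t ∈ U, osc g U = g s - g t ∧ ∀ u ∈ U, g u ∈ Icc (g t) (g s) := by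
  obtain ⟨s, hs, hmax⟩ := hU.exists_isMaxOn hne hg
  obtain ⟨t, ht, hmin⟩ := hU.exists_isMinOn hne hg
  refine ⟨s, hs, t, ht, le_antisymm (osc_le hne fun u hu v hv => ?_) ?_, fun u hu =>
    ⟨hmin hu, hmax hu⟩⟩
  · exact abs_sub_le_of_le_of_le (hmin hu) (hmax hu) (hmin hv) (hmax hv)
  · exact (le_abs_self _).trans (abs_sub_le_osc hU hg hs ht)

theorem abs_osc_sub_mul_osc_le (hU : IsCompact U) (hne : U.Nonempty) (hf : ContinuousOn f U)
    (hg : ContinuousOn g U) {c e : ℝ} (hc : 0 ≤ c)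
    (h : ∀ s ∈ U, ∀ t ∈ U, |(g s - g t) - c * (f s - f t)| ≤ e) :
    |osc g U - c * osc f U| ≤ e := by
  obtain ⟨s, hs, t, ht, hosc, -⟩ := exists_osc_eq hU hne hf
  obtain ⟨s', hs', t', ht', hosc', -⟩ := exists_osc_eq hU hne hg
  have hf' := mul_le_mul_of_nonneg_left ((le_abs_self _).trans (abs_sub_le_osc hU hf hs' ht')) hc
  have hg' := (le_abs_self _).trans (abs_sub_le_osc hU hg hs ht)
  have hdiff := abs_le.1 (h s hs t ht)
  have hdiff' := abs_le.1 (h s' hs' t' ht')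
  rw [← hosc] at hdiff
  rw [← hosc'] at hdiff'
  exact abs_le.2 ⟨by linarith, by linarith⟩

theorem abs_le_maxAbs (hf : ContinuousOn f (Icc 0 1)) (ht : t ∈ Icc 0 1) : |f t| ≤ maxAbs f :=
  le_csSup (isCompact_Icc.bddAbove_image hf.abs) (mem_image_of_mem (fun t => |f t|) ht)

end Osc

section OscSum

variable {N k j : ℕ} {S f φ : ℝ → ℝ} {L : ℝ≥0} {a d : Fin N → ℝ} {J : Set ℝ} {s t x δ ρ : ℝ}

theorem oscSum_succ (N : ℕ) (f : ℝ → ℝ) (k : ℕ) :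
    oscSum N f 0 1 (k + 1) =
      ∑ i : Fin N, ∑ j ∈ Finset.range (N ^ k), osc (f ∘ branch i) (subInterval N 0 1 k j) := by
  simp only [oscSum, sum_range_pow_succ, ← image_branch_subInterval, osc_image]

theorem continuousOn_comp_branch (hf : ContinuousOn f (Icc 0 1)) (i : Fin N) :
    ContinuousOn (f ∘ branch i) (Icc 0 1) :=
  hf.comp (lipschitzWith_branch i).continuous.continuousOn (mapsTo_branch i)

theorem sum_range_pow_div (hN : 0 < N) (k : ℕ) (c : ℝ) :
    ∑ _j ∈ Finset.range (N ^ k), c * (1 / (N : ℝ) ^ k) = c := by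
  rw [Finset.sum_const, Finset.card_range, nsmul_eq_mul, Nat.cast_pow]
  field_simp

theorem SelfAffine.abs_increment_sub_le (hf : SelfAffine S f a d)
    (hS : LipschitzOnWith L S (Icc 0 1)) (hs : s ∈ Icc 0 1) (ht : t ∈ Icc 0 1) (hx : x ∈ Icc 0 1)
    (i : Fin N) :
    |f (branch i s) - f (branch i t) - S (branch i x) * (f s - f t) - d i * (s - t)| ≤
      L / N * (dist s x * |f s| + dist t x * |f t|) := by
  have hSx {u : ℝ} (hu : u ∈ Icc 0 1) :
      |(S (branch i u) - S (branch i x)) * f u| ≤ L / N * (dist u x * |f u|) := by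
    have hlip := hS.dist_le_mul _ (mapsTo_branch i hu) _ (mapsTo_branch i hx)
    rw [Real.dist_eq, Real.dist_eq, branch_sub_branch, abs_div, Nat.abs_cast,
      ← mul_div_assoc,
      mul_div_right_comm] at hlip
    rw [abs_mul, ← mul_assoc]
    exact mul_le_mul_of_nonneg_right hlip (abs_nonneg _)
  have hsplit : f (branch i s) - f (branch i t) - S (branch i x) * (f s - f t) - d i * (s - t) =
      (S (branch i s) - S (branch i x)) * f s - (S (branch i t) - S (branch i x)) * f t := by
    rw [hf i s hs, hf i t ht]
    ring
  rw [hsplit, mul_add]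
  exact (abs_sub _ _).trans (add_le_add (hSx hs) (hSx ht))

/-- Adding up the increments over all branches removes the contribution of the slopes `d`. -/
theorem SelfAffine.gammaMin_mul_osc_sub_le (hf : SelfAffine S f a d) (hN : 0 < N)
    (hd : ∑ i, d i = 0) (hS : LipschitzOnWith L S (Icc 0 1)) (hS0 : ∀ t ∈ Icc 0 1, 0 ≤ S t)
    (hfc : ContinuousOn f (Icc 0 1)) (hJ : IsCompact J) (hne : J.Nonempty) (hJI : J ⊆ Icc 0 1)
    (hδ : ∀ s ∈ J, ∀ t ∈ J, dist s t ≤ δ) :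
    gammaMin N S * osc f J - L * maxAbs f * δ ≤ ∑ i : Fin N, osc (f ∘ branch i) J := by
  obtain ⟨s, hs, t, ht, hosc, -⟩ := exists_osc_eq hJ hne (hfc.mono hJI)
  have hbranch (i : Fin N) : S (branch i s) * osc f J + d i * (s - t) - L / N * (δ * maxAbs f) ≤
      osc (f ∘ branch i) J := by
    have hinc := (abs_le.1 (hf.abs_increment_sub_le hS (hJI hs) (hJI ht) (hJI hs) i)).1
    have hosc_i := (le_abs_self _).trans
      (abs_sub_le_osc hJ ((continuousOn_comp_branch hfc i).mono hJI) hs ht)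
    have herr : L / N * (dist t s * |f t|) ≤ L / N * (δ * maxAbs f) := by
      gcongr
      exacts [dist_nonneg.trans (hδ t ht s hs), hδ t ht s hs, abs_le_maxAbs hfc (hJI ht)]
    rw [dist_self, zero_mul, zero_add] at hinc
    simp only [Function.comp_apply] at hosc_i
    rw [hosc]
    linarith
  calc gammaMin N S * osc f J - L * maxAbs f * δ
      ≤ (∑ i : Fin N, S (branch i s)) * osc f J - L * maxAbs f * δ := by
        gcongr
        exacts [osc_nonneg _ _, gammaMin_le hS0 (hJI hs)]
    _ = ∑ i : Fin N, (S (branch i s) * osc f J + d i * (s - t) - L / N * (δ * maxAbs f)) := by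
        rw [Finset.sum_sub_distrib, Finset.sum_add_distrib, ← Finset.sum_mul, ← Finset.sum_mul, hd,
          Finset.sum_const, Finset.card_univ, Fintype.card_fin, nsmul_eq_mul]
        field_simp
        ring
    _ ≤ ∑ i : Fin N, osc (f ∘ branch i) J := Finset.sum_le_sum fun i _ => hbranch i

theorem SelfAffine.gammaMin_mul_oscSum_sub_le (hf : SelfAffine S f a d) (hN : 0 < N)
    (hd : ∑ i, d i = 0) (hS : LipschitzOnWith L S (Icc 0 1)) (hS0 : ∀ t ∈ Icc 0 1, 0 ≤ S t)
    (hfc : ContinuousOn f (Icc 0 1)) (k : ℕ) :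
    gammaMin N S * oscSum N f 0 1 k - L * maxAbs f ≤ oscSum N f 0 1 (k + 1) := by
  rw [oscSum_succ, Finset.sum_comm, oscSum, Finset.mul_sum,
    ← sum_range_pow_div hN k (L * maxAbs f), ← Finset.sum_sub_distrib]
  exact Finset.sum_le_sum fun j hj => hf.gammaMin_mul_osc_sub_le hN hd hS hS0 hfc isCompact_Icc
    ⟨_, left_mem_subInterval N k j⟩ (subInterval_subset (Finset.mem_range.1 hj))
    fun _ hs _ ht => dist_le_of_mem_subInterval hs ht

theorem SelfAffine.abs_osc_comp_branch_sub_le (hf : SelfAffine S f a d)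
    (hS : LipschitzOnWith L S (Icc 0 1)) (hS0 : ∀ t ∈ Icc 0 1, 0 ≤ S t)
    (hfc : ContinuousOn f (Icc 0 1)) (hJ : IsCompact J) (hJI : J ⊆ Icc 0 1)
    (hδ : ∀ s ∈ J, ∀ t ∈ J, dist s t ≤ δ) (hx : x ∈ J) (i : Fin N) :
    |osc (f ∘ branch i) J - S (branch i x) * osc f J| ≤ (2 * L * maxAbs f + |d i|) * δ := by
  refine abs_osc_sub_mul_osc_le hJ ⟨x, hx⟩ (hfc.mono hJI)
    ((continuousOn_comp_branch hfc i).mono hJI) (hS0 _ (mapsTo_branch i (hJI hx)))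
    fun s hs t ht => ?_
  have hδ0 : 0 ≤ δ := dist_nonneg.trans (hδ s hs t ht)
  have hpoint {u : ℝ} (hu : u ∈ J) : dist u x * |f u| ≤ δ * maxAbs f :=
    mul_le_mul (hδ u hu x hx) (abs_le_maxAbs hfc (hJI hu)) (abs_nonneg _) hδ0
  have hslope : |d i * (s - t)| ≤ |d i| * δ := by
    rw [abs_mul]
    exact mul_le_mul_of_nonneg_left (hδ s hs t ht) (abs_nonneg _)
  have hLN : (L : ℝ) / N ≤ L := div_le_self L.coe_nonneg (Nat.one_le_cast.2 i.pos)
  calc |f (branch i s) - f (branch i t) - S (branch i x) * (f s - f t)|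
      = |f (branch i s) - f (branch i t) - S (branch i x) * (f s - f t) - d i * (s - t) +
          d i * (s - t)| := by rw [sub_add_cancel]
    _ ≤ L / N * (dist s x * |f s| + dist t x * |f t|) + |d i| * δ := (abs_add_le _ _).trans
        (add_le_add (hf.abs_increment_sub_le hS (hJI hs) (hJI ht) (hJI hx) i) hslope)
    _ ≤ L * (δ * maxAbs f + δ * maxAbs f) + |d i| * δ := by
        grw [hLN, hpoint hs, hpoint ht]
    _ = (2 * L * maxAbs f + |d i|) * δ := by ring

/-- The sum of the oscillations of `f` over the cells of level `k`, weighted by the values of `φ` at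
their left end points. -/
noncomputable def weightedOsc (N : ℕ) (f φ : ℝ → ℝ) (k : ℕ) : ℝ :=
  ∑ j ∈ Finset.range (N ^ k), φ (gridPoint N k j) * osc f (subInterval N 0 1 k j)

theorem weightedOsc_succ (N : ℕ) (f φ : ℝ → ℝ) (k : ℕ) :
    weightedOsc N f φ (k + 1) = ∑ i : Fin N, ∑ j ∈ Finset.range (N ^ k),
      φ (branch i (gridPoint N k j)) * osc (f ∘ branch i) (subInterval N 0 1 k j) := by
  simp only [weightedOsc, sum_range_pow_succ, ← image_branch_subInterval, osc_image,
    branch_gridPoint]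

theorem mul_weightedOsc_eq_sum_branch
    (hρ : ∀ x ∈ Icc 0 1, transfer (branch (N := N)) S φ x = ρ * φ x) (f : ℝ → ℝ) (k : ℕ) :
    ρ * weightedOsc N f φ k = ∑ i : Fin N, ∑ j ∈ Finset.range (N ^ k),
      φ (branch i (gridPoint N k j)) *
        (S (branch i (gridPoint N k j)) * osc f (subInterval N 0 1 k j)) := by
  rw [weightedOsc, Finset.mul_sum, Finset.sum_comm]
  refine Finset.sum_congr rfl fun j hj => ?_
  rw [← mul_assoc, ← hρ _ (gridPoint_mem_Icc (Finset.mem_range.1 hj)), transfer_apply,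
    Finset.sum_mul]
  exact Finset.sum_congr rfl fun i _ => by ring

theorem SelfAffine.exists_abs_weightedOsc_succ_sub_le (hf : SelfAffine S f a d) (hN : 0 < N)
    (hS : LipschitzOnWith L S (Icc 0 1)) (hS0 : ∀ t ∈ Icc 0 1, 0 ≤ S t)
    (hfc : ContinuousOn f (Icc 0 1)) {b : ℝ} (hφ : ∀ x ∈ Icc 0 1, φ x ∈ Icc 0 b)
    (hρ : ∀ x ∈ Icc 0 1, transfer (branch (N := N)) S φ x = ρ * φ x) :
    ∃ C, ∀ k, |weightedOsc N f φ (k + 1) - ρ * weightedOsc N f φ k| ≤ C := by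
  refine ⟨∑ i, b * (2 * L * maxAbs f + |d i|), fun k => ?_⟩
  simp only [weightedOsc_succ, mul_weightedOsc_eq_sum_branch hρ, ← Finset.sum_sub_distrib,
    ← mul_sub]
  refine (Finset.abs_sum_le_sum_abs _ _).trans (Finset.sum_le_sum fun i _ => ?_)
  rw [← sum_range_pow_div hN k (b * _)]
  refine (Finset.abs_sum_le_sum_abs _ _).trans (Finset.sum_le_sum fun j hj => ?_)
  have hj := Finset.mem_range.1 hj
  have hφx := hφ _ (mapsTo_branch i (gridPoint_mem_Icc hj))
  rw [abs_mul, abs_of_nonneg hφx.1, mul_assoc]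
  exact mul_le_mul hφx.2 (hf.abs_osc_comp_branch_sub_le hS hS0 hfc isCompact_Icc
    (subInterval_subset hj) (fun _ hs _ ht => dist_le_of_mem_subInterval hs ht)
    (left_mem_subInterval N k j) i) (abs_nonneg _) (hφx.1.trans hφx.2)

theorem weightedOsc_mem_Icc {a b : ℝ} (hφ : ∀ x ∈ Icc 0 1, φ x ∈ Icc a b) (N : ℕ) (f : ℝ → ℝ)
    (k : ℕ) :
    weightedOsc N f φ k ∈ Icc (a * oscSum N f 0 1 k) (b * oscSum N f 0 1 k) := by
  have hcell {j : ℕ} (hj : j ∈ Finset.range (N ^ k)) :=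
    hφ _ (gridPoint_mem_Icc (Finset.mem_range.1 hj))
  rw [weightedOsc, oscSum, Finset.mul_sum, Finset.mul_sum]
  exact ⟨Finset.sum_le_sum fun j hj => mul_le_mul_of_nonneg_right (hcell hj).1 (osc_nonneg _ _),
    Finset.sum_le_sum fun j hj => mul_le_mul_of_nonneg_right (hcell hj).2 (osc_nonneg _ _)⟩

end OscSum

section Growth

variable {r C : ℝ} {u : ℕ → ℝ}

theorem mul_pow_le_of_recurrence (hr : 1 < r) (hu : ∀ k, r * u k - C ≤ u (k + 1)) (m n : ℕ) :
    (u m - C / (r - 1)) * r ^ n ≤ u (m + n) - C / (r - 1) := by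
  have hfix : r * (C / (r - 1)) = C / (r - 1) + C := by
    have hr1 : r - 1 ≠ 0 := (sub_pos.2 hr).ne'
    field_simp
    ring
  rw [mul_comm]
  refine geom_le (u := fun k => u (m + k) - C / (r - 1)) (zero_le_one.trans hr.le) n fun k _ => ?_
  have hstep := hu (m + k)
  rw [add_assoc] at hstep
  rw [mul_sub, hfix]
  linarith

theorem isTheta_pow_of_recurrence (hr : 1 < r) (hu : ∀ k, |u (k + 1) - r * u k| ≤ C)
    (hlim : Tendsto u atTop atTop) : u =Θ[atTop] fun k => r ^ k := by
  set e := C / (r - 1)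
  have : 0 < r := zero_lt_one.trans hr
  have he : 0 ≤ e := div_nonneg ((abs_nonneg _).trans (hu 0)) (sub_pos.2 hr).le
  obtain ⟨m, hm⟩ := (hlim.eventually_gt_atTop e).exists
  have hlow : ∀ᶠ k in atTop, (u m - e) / r ^ m * r ^ k ≤ u k := by
    filter_upwards [eventually_ge_atTop m] with k hk
    obtain ⟨n, rfl⟩ := Nat.exists_eq_add_of_le hk
    have := mul_pow_le_of_recurrence (u := u) (C := C) hr
      (fun k => by linarith [(abs_le.1 (hu k)).1]) m n
    rw [pow_add, ← mul_assoc, div_mul_cancel₀ _ (by positivity)]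
    linarith
  have hup (k : ℕ) : u k ≤ (u 0 + e) * r ^ k := by
    have := mul_pow_le_of_recurrence (u := -u) (C := C) hr
      (fun k => by simp only [Pi.neg_apply]; linarith [(abs_le.1 (hu k)).2]) 0 k
    rw [zero_add, Pi.neg_apply, Pi.neg_apply] at this
    linarith
  constructor
  · refine IsBigO.of_bound (u 0 + e) ?_
    filter_upwards [hlim.eventually_ge_atTop 0] with k hk
    rw [Real.norm_of_nonneg hk, Real.norm_of_nonneg (by positivity)]
    exact hup k
  · refine IsBigO.of_bound ((u m - e) / r ^ m)⁻¹ ?_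
    filter_upwards [hlow, hlim.eventually_ge_atTop 0] with k hk hk0
    rw [Real.norm_of_nonneg (by positivity), Real.norm_of_nonneg hk0, ← div_eq_inv_mul,
      le_div_iff₀' (div_pos (sub_pos.2 hm) (by positivity))]
    exact hk

theorem tendsto_log_div_of_isTheta_pow (hr : 0 < r) (hu : u =Θ[atTop] fun k => r ^ k) :
    Tendsto (fun k => Real.log (u k) / k) atTop (𝓝 (Real.log r)) := by
  obtain ⟨b, hb, hup⟩ := hu.1.exists_pos
  obtain ⟨a, ha, hlow⟩ := hu.2.exists_pos
  have hlim (c : ℝ) :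
      Tendsto (fun k : ℕ => Real.log c / k + Real.log r) atTop (𝓝 (Real.log r)) := by
    simpa using (tendsto_const_div_atTop_nhds_zero_nat (Real.log c)).add_const (Real.log r)
  have hlog {c : ℝ} (hc : 0 < c) {k : ℕ} (hk : k ≠ 0) :
      Real.log (c * r ^ k) / k = Real.log c / k + Real.log r := by
    rw [Real.log_mul hc.ne' (by positivity), Real.log_pow, add_div, mul_div_cancel_left₀]
    exact Nat.cast_ne_zero.2 hk
  refine tendsto_of_tendsto_of_tendsto_of_le_of_le' (hlim a⁻¹) (hlim b) ?_ ?_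
  all_goals
    filter_upwards [hup.bound, hlow.bound, eventually_ne_atTop 0] with k hup hlow hk
    rw [Real.norm_of_nonneg (pow_pos hr k).le, Real.norm_eq_abs] at hup hlow
    have hlow' : a⁻¹ * r ^ k ≤ |u k| := by rwa [← div_eq_inv_mul, div_le_iff₀' ha]
    have huk : 0 < |u k| := (by positivity : 0 < a⁻¹ * r ^ k).trans_le hlow'
    rw [← hlog (by positivity) hk, ← Real.log_abs (u k)]
    gcongr

end Growth

section OscGrowth

variable {N : ℕ} {S f φ : ℝ → ℝ} {K L : ℝ≥0} {a d : Fin N → ℝ} {ρ : ℝ}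

theorem SelfAffine.tendsto_oscSum_atTop (hf : SelfAffine S f a d) (hN : 0 < N)
    (hd : ∑ i, d i = 0) (hS : LipschitzOnWith L S (Icc 0 1)) (hS0 : ∀ t ∈ Icc 0 1, 0 ≤ S t)
    (hfc : ContinuousOn f (Icc 0 1)) (hγ : 1 < gammaMin N S)
    (hosc : ∃ k, L * maxAbs f / (gammaMin N S - 1) < oscSum N f 0 1 k) :
    Tendsto (oscSum N f 0 1) atTop atTop := by
  obtain ⟨m, hm⟩ := hosc
  refine (tendsto_add_atTop_iff_nat m).1 (tendsto_atTop_mono (fun n => ?_)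
    ((tendsto_pow_atTop_atTop_of_one_lt hγ).const_mul_atTop (sub_pos.2 hm)))
  have hgrow := mul_pow_le_of_recurrence hγ (hf.gammaMin_mul_oscSum_sub_le hN hd hS hS0 hfc) m n
  have herr : 0 ≤ L * maxAbs f / (gammaMin N S - 1) :=
    div_nonneg (mul_nonneg L.coe_nonneg ((abs_nonneg _).trans
      (abs_le_maxAbs hfc (left_mem_Icc.2 zero_le_one)))) (sub_pos.2 hγ).le
  rw [add_comm n m]
  linarith

theorem gammaMin_le_of_transfer_eq_mul (hS0 : ∀ t ∈ Icc 0 1, 0 ≤ S t)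
    (hφ : LogLipschitzOn K φ (Icc 0 1))
    (hρ : ∀ x ∈ Icc 0 1, transfer (branch (N := N)) S φ x = ρ * φ x) : gammaMin N S ≤ ρ := by
  obtain ⟨a, b, ha, hab⟩ := hφ.exists_mem_Icc (Metric.isBounded_Icc 0 1)
  exact le_of_transfer_eq_mul (nonempty_Icc.2 zero_le_one) mapsTo_branch hS0 ha
    (fun x hx => (hab x hx).1) hρ fun x hx => gammaMin_le hS0 hx

theorem SelfAffine.oscSum_isTheta_pow (hf : SelfAffine S f a d) (hN : 0 < N)
    (hS : LipschitzOnWith L S (Icc 0 1)) (hS0 : ∀ t ∈ Icc 0 1, 0 ≤ S t)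
    (hfc : ContinuousOn f (Icc 0 1)) (hlim : Tendsto (oscSum N f 0 1) atTop atTop)
    (hφ : LogLipschitzOn K φ (Icc 0 1))
    (hρ : ∀ x ∈ Icc 0 1, transfer (branch (N := N)) S φ x = ρ * φ x) (hρ1 : 1 < ρ) :
    oscSum N f 0 1 =Θ[atTop] fun k => ρ ^ k := by
  obtain ⟨a, b, ha, hab⟩ := hφ.exists_mem_Icc (Metric.isBounded_Icc 0 1)
  obtain ⟨C, hC⟩ := hf.exists_abs_weightedOsc_succ_sub_le hN hS hS0 hfc
    (fun x hx => ⟨(hφ.pos x hx).le, (hab x hx).2⟩) hρ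
  have hW := weightedOsc_mem_Icc hab N f
  have hWtop : Tendsto (weightedOsc N f φ) atTop atTop :=
    tendsto_atTop_mono (fun k => (hW k).1) (hlim.const_mul_atTop ha)
  have hcomp : oscSum N f 0 1 =Θ[atTop] weightedOsc N f φ := by
    constructor
    · refine IsBigO.of_bound a⁻¹ ?_
      filter_upwards [hlim.eventually_ge_atTop 0, hWtop.eventually_ge_atTop 0] with k hO hWk
      rw [Real.norm_of_nonneg hO, Real.norm_of_nonneg hWk, ← div_eq_inv_mul, le_div_iff₀' ha]
      exact (hW k).1
    · refine IsBigO.of_bound b ?_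
      filter_upwards [hlim.eventually_ge_atTop 0, hWtop.eventually_ge_atTop 0] with k hO hWk
      rw [Real.norm_of_nonneg hO, Real.norm_of_nonneg hWk]
      exact (hW k).2
  exact hcomp.trans (isTheta_pow_of_recurrence hρ1 hC hWtop)

end OscGrowth

/-! ### Counting squares along a graph -/

section Squares

variable {ε a b x : ℝ} {f : ℝ → ℝ}

/-- The indices `m` for which `[m ε, (m + 1) ε]` meets `[a, b]`. -/
noncomputable def gridIndices (ε a b : ℝ) : Finset ℤ := Finset.Icc (⌈a / ε⌉ - 1) ⌊b / ε⌋

theorem mem_gridIndices (hε : 0 < ε) (hx : x ∈ Icc a b) {m : ℤ}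
    (hm : x ∈ Icc (m * ε) ((m + 1) * ε)) : m ∈ gridIndices ε a b := by
  rw [gridIndices, Finset.mem_Icc, sub_le_iff_le_add, Int.ceil_le, Int.le_floor]
  push_cast
  exact ⟨(div_le_iff₀ hε).2 (hx.1.trans hm.2), (le_div_iff₀ hε).2 (hm.1.trans hx.2)⟩

theorem card_gridIndices_le (hε : 0 < ε) (hab : a ≤ b) :
    ((gridIndices ε a b).card : ℝ) ≤ (b - a) / ε + 2 := by
  have hcard : ((⌊b / ε⌋ + 1 - (⌈a / ε⌉ - 1) : ℤ) : ℝ) ≤ (b - a) / ε + 2 := by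
    push_cast
    rw [sub_div]
    linarith [Int.floor_le (b / ε), Int.le_ceil (a / ε)]
  rw [gridIndices, Int.card_Icc, ← Int.cast_natCast, Int.toNat_eq_max, Int.cast_max, Int.cast_zero]
  exact max_le hcard (add_nonneg (div_nonneg (sub_nonneg.2 hab) hε.le) zero_le_two)

/-- The indices of the `ε`-coordinate squares that meet the graph of `f` over `U`. -/
def graphSquares (f : ℝ → ℝ) (U : Set ℝ) (ε : ℝ) : Set (ℤ × ℤ) :=
  {p | ∃ t ∈ U, (t, f t) ∈ coordSquare ε p}

theorem boxCount_graphOver (f : ℝ → ℝ) (a b ε : ℝ) :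
    boxCount (graphOver f a b) ε = (graphSquares f (Icc a b) ε).ncard := by
  refine congrArg Set.ncard (Set.ext fun p => ?_)
  rw [mem_ofPred_eq, inter_comm]
  exact exists_mem_image (p := (· ∈ coordSquare ε p))

theorem exists_finset_graphSquares_subset (hε : 0 < ε) (hab : a ≤ b)
    (hf : ContinuousOn f (Icc a b)) :
    ∃ G : Finset (ℤ × ℤ), graphSquares f (Icc a b) ε ⊆ G ∧
      (G.card : ℝ) ≤ ((b - a) / ε + 2) * (osc f (Icc a b) / ε + 2) := by
  obtain ⟨s, hs, t, -, hosc, hrange⟩ := exists_osc_eq isCompact_Icc (nonempty_Icc.2 hab) hf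
  refine ⟨gridIndices ε a b ×ˢ gridIndices ε (f t) (f s), ?_, ?_⟩
  · rintro p ⟨u, hu, hp⟩
    exact Finset.mem_coe.2 (Finset.mem_product.2
      ⟨mem_gridIndices hε hu hp.1, mem_gridIndices hε (hrange u hu) hp.2⟩)
  · rw [Finset.card_product, Nat.cast_mul, hosc]
    exact mul_le_mul (card_gridIndices_le hε hab) (card_gridIndices_le hε (hrange s hs).1)
      (Nat.cast_nonneg _) (add_nonneg (div_nonneg (sub_nonneg.2 hab) hε.le) zero_le_two)

theorem finite_graphSquares (hε : 0 < ε) (hab : a ≤ b) (hf : ContinuousOn f (Icc a b)) :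
    (graphSquares f (Icc a b) ε).Finite := by
  obtain ⟨G, hG, -⟩ := exists_finset_graphSquares_subset hε hab hf
  exact G.finite_toSet.subset hG

theorem ncard_graphSquares_le (hε : 0 < ε) (hab : a ≤ b) (hf : ContinuousOn f (Icc a b)) :
    ((graphSquares f (Icc a b) ε).ncard : ℝ) ≤ ((b - a) / ε + 2) * (osc f (Icc a b) / ε + 2) := by
  obtain ⟨G, hG, hcard⟩ := exists_finset_graphSquares_subset hε hab hf
  refine le_trans ?_ hcard
  rw [← ncard_coe_finset, Nat.cast_le]
  exact ncard_le_ncard hG G.finite_toSet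

theorem mk_floor_mem_graphSquares (hε : 0 < ε) {U : Set ℝ} (hx : x ∈ U) (f : ℝ → ℝ) :
    (⌊x / ε⌋, ⌊f x / ε⌋) ∈ graphSquares f U ε := by
  have hfloor (v : ℝ) : v ∈ Icc (⌊v / ε⌋ * ε) ((⌊v / ε⌋ + 1) * ε) :=
    ⟨(le_div_iff₀ hε).1 (Int.floor_le _), (div_le_iff₀ hε).1 (Int.lt_floor_add_one _).le⟩
  exact ⟨x, hx, hfloor x, hfloor (f x)⟩

theorem osc_div_le_ncard_graphSquares (hε : 0 < ε) (hab : a ≤ b) (hf : ContinuousOn f (Icc a b)) :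
    osc f (Icc a b) / ε ≤ (graphSquares f (Icc a b) ε).ncard := by
  obtain ⟨s, hs, t, ht, hosc, hrange⟩ := exists_osc_eq isCompact_Icc (nonempty_Icc.2 hab) hf
  have hrows : ↑(Finset.Icc ⌊f t / ε⌋ ⌊f s / ε⌋) ⊆ Prod.snd '' graphSquares f (Icc a b) ε := by
    intro m hm
    obtain ⟨hm1, hm2⟩ := Finset.mem_Icc.1 (Finset.mem_coe.1 hm)
    have hmax : max (f t) (m * ε) ∈ Icc (f t) (f s) :=
      ⟨le_max_left _ _, max_le (hrange s hs).1 ((le_div_iff₀ hε).1 (Int.le_floor.1 hm2))⟩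
    obtain ⟨x, hx, hfx⟩ := isPreconnected_Icc.intermediate_value ht hs hf hmax
    refine ⟨_, mk_floor_mem_graphSquares hε hx f, Int.floor_eq_iff.2 ?_⟩
    rw [hfx, ← max_div_div_right hε.le, mul_div_cancel_right₀ _ hε.ne']
    exact ⟨le_max_right _ _, max_lt (Int.floor_le_iff.1 hm1) (lt_add_one _)⟩
  have hfin := finite_graphSquares hε hab hf
  have hcard := (ncard_le_ncard hrows (hfin.image _)).trans (ncard_image_le hfin)
  rw [ncard_coe_finset, Int.card_Icc] at hcard
  have hcard' : ((⌊f s / ε⌋ + 1 - ⌊f t / ε⌋ : ℤ) : ℝ) ≤ (graphSquares f (Icc a b) ε).ncard := by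
    exact_mod_cast (Int.self_le_toNat _).trans (Int.ofNat_le.2 hcard)
  push_cast at hcard'
  rw [hosc, sub_div]
  linarith [Int.lt_floor_add_one (f s / ε), Int.floor_le (f t / ε)]

end Squares

section BoxCount

variable {N k : ℕ} {f : ℝ → ℝ} {ε : ℝ}

theorem boxCount_le (hN : 0 < N) (hf : ContinuousOn f (Icc 0 1)) (k : ℕ) (hε : 0 < ε) :
    (boxCount (graphOver f 0 1) ε : ℝ) ≤
      (1 / (ε * N ^ k) + 2) * (oscSum N f 0 1 k / ε + 2 * N ^ k) := by
  have hcover : graphSquares f (Icc 0 1) ε ⊆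
      ⋃ j ∈ Finset.range (N ^ k), graphSquares f (subInterval N 0 1 k j) ε := by
    rintro p ⟨t, ht, hp⟩
    obtain ⟨j, hj, htj⟩ := exists_mem_subInterval hN k ht
    exact mem_biUnion (Finset.mem_coe.2 (Finset.mem_range.2 hj)) ⟨t, htj, hp⟩
  have hcell {j : ℕ} (hj : j ∈ Finset.range (N ^ k)) :
      (graphSquares f (subInterval N 0 1 k j) ε).Finite ∧
      ((graphSquares f (subInterval N 0 1 k j) ε).ncard : ℝ) ≤
        (1 / (ε * N ^ k) + 2) * (osc f (subInterval N 0 1 k j) / ε + 2) := by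
    have hfj := hf.mono (subInterval_subset (Finset.mem_range.1 hj))
    have hmesh : gridPoint N k (j + 1) - gridPoint N k j = 1 / N ^ k := by
      rw [gridPoint, gridPoint, Nat.cast_succ]
      ring
    rw [subInterval_eq_Icc] at hfj ⊢
    have hle := ncard_graphSquares_le hε (gridPoint_le_succ N k j) hfj
    rw [hmesh, div_div, mul_comm _ ε] at hle
    exact ⟨finite_graphSquares hε (gridPoint_le_succ N k j) hfj, hle⟩
  have hunion : (boxCount (graphOver f 0 1) ε : ℝ) ≤
      ∑ j ∈ Finset.range (N ^ k), ((graphSquares f (subInterval N 0 1 k j) ε).ncard : ℝ) := by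
    rw [boxCount_graphOver]
    exact_mod_cast (ncard_le_ncard hcover
      ((Finset.range (N ^ k)).finite_toSet.biUnion fun j hj => (hcell hj).1)).trans
      (Finset.set_ncard_biUnion_le _ _)
  refine hunion.trans ((Finset.sum_le_sum fun j hj => (hcell hj).2).trans_eq ?_)
  rw [← Finset.mul_sum, Finset.sum_add_distrib, ← Finset.sum_div, Finset.sum_const,
    Finset.card_range, nsmul_eq_mul, ← oscSum, Nat.cast_pow, mul_comm (_ ^ k) (2 : ℝ)]

open Classical in
theorem card_cells_meeting_square_le (hN : 0 < N) (f : ℝ → ℝ) (k : ℕ) (hε : 0 < ε) (p : ℤ × ℤ) :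
    (((Finset.range (N ^ k)).filter
      fun j => p ∈ graphSquares f (subInterval N 0 1 k j) ε).card : ℝ) ≤ ε * N ^ k + 2 := by
  have hNk : (0 : ℝ) < 1 / N ^ k := by positivity
  have hcard : ((Finset.range (N ^ k)).filter
      fun j => p ∈ graphSquares f (subInterval N 0 1 k j) ε).card ≤
      (gridIndices (1 / N ^ k) (p.1 * ε) ((p.1 + 1) * ε)).card := by
    refine Finset.card_le_card_of_injOn (fun j : ℕ => (j : ℤ)) (fun j hj => ?_)
      Nat.cast_injective.injOn
    obtain ⟨-, t, ht, hp⟩ := Finset.mem_filter.1 hj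
    refine mem_gridIndices hNk hp.1 ?_
    rw [subInterval_eq_Icc, gridPoint, gridPoint, Nat.cast_succ] at ht
    rwa [mul_one_div, mul_one_div, Int.cast_natCast]
  refine (Nat.cast_le.2 hcard).trans
    ((card_gridIndices_le hNk (by linarith)).trans_eq ?_)
  rw [div_div_eq_mul_div]
  ring

theorem oscSum_div_le_mul_boxCount (hN : 0 < N) (hf : ContinuousOn f (Icc 0 1)) (k : ℕ)
    (hε : 0 < ε) :
    oscSum N f 0 1 k / ε ≤ (ε * N ^ k + 2) * boxCount (graphOver f 0 1) ε := by
  classical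
  have hfin := finite_graphSquares hε zero_le_one hf
  let meets (j : ℕ) (p : ℤ × ℤ) : Prop := p ∈ graphSquares f (subInterval N 0 1 k j) ε
  have hrow {j : ℕ} (hj : j ∈ Finset.range (N ^ k)) :
      osc f (subInterval N 0 1 k j) / ε ≤ (hfin.toFinset.bipartiteAbove meets j).card := by
    have hsub := subInterval_subset (Finset.mem_range.1 hj)
    have hsquares : (hfin.toFinset.bipartiteAbove meets j : Set (ℤ × ℤ)) =
        graphSquares f (subInterval N 0 1 k j) ε := by
      ext p
      rw [Finset.mem_coe, Finset.mem_bipartiteAbove, Finite.mem_toFinset, and_iff_right_iff_imp]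
      exact fun ⟨t, ht, hp⟩ => ⟨t, hsub ht, hp⟩
    rw [← ncard_coe_finset, hsquares]
    have hfj := hf.mono hsub
    rw [subInterval_eq_Icc] at hfj ⊢
    exact osc_div_le_ncard_graphSquares hε (gridPoint_le_succ N k j) hfj
  calc oscSum N f 0 1 k / ε
      = ∑ j ∈ Finset.range (N ^ k), osc f (subInterval N 0 1 k j) / ε := Finset.sum_div ..
    _ ≤ ∑ j ∈ Finset.range (N ^ k), ((hfin.toFinset.bipartiteAbove meets j).card : ℝ) :=
        Finset.sum_le_sum fun _ => hrow
    _ = ∑ p ∈ hfin.toFinset, (((Finset.range (N ^ k)).bipartiteBelow meets p).card : ℝ) := by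
        exact_mod_cast Finset.sum_card_bipartiteAbove_eq_sum_card_bipartiteBelow meets
    _ ≤ ∑ _p ∈ hfin.toFinset, (ε * N ^ k + 2) :=
        Finset.sum_le_sum fun p _ => card_cells_meeting_square_le hN f k hε p
    _ = (ε * N ^ k + 2) * boxCount (graphOver f 0 1) ε := by
        rw [Finset.sum_const, nsmul_eq_mul, mul_comm, boxCount_graphOver,
          ncard_eq_toFinset_card _ hfin]

theorem boxCount_mem_Icc (hN : 0 < N) (hf : ContinuousOn f (Icc 0 1)) (hε : 0 < ε)
    (hk : ε * N ^ k ∈ Icc 1 (N : ℝ)) (hosc : 1 ≤ oscSum N f 0 1 k) :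
    (boxCount (graphOver f 0 1) ε : ℝ) ∈ Icc ((1 / (N * (N + 2))) * (N ^ k * oscSum N f 0 1 k))
      (9 * (N ^ k * oscSum N f 0 1 k)) := by
  have hNk : (0 : ℝ) < N ^ k := by positivity
  have : (0 : ℝ) < N := Nat.cast_pos.2 hN
  constructor
  · have hinv : (N : ℝ) ^ k ≤ N / ε := (le_div_iff₀' hε).2 hk.2
    rw [one_div_mul_eq_div, div_le_iff₀ (by positivity)]
    calc (N : ℝ) ^ k * oscSum N f 0 1 k ≤ N / ε * oscSum N f 0 1 k := by gcongr
      _ = N * (oscSum N f 0 1 k / ε) := by ring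
      _ ≤ N * ((ε * N ^ k + 2) * boxCount (graphOver f 0 1) ε) := by
          gcongr; exact oscSum_div_le_mul_boxCount hN hf k hε
      _ ≤ N * ((N + 2) * boxCount (graphOver f 0 1) ε) := by gcongr; exact hk.2
      _ = boxCount (graphOver f 0 1) ε * (N * (N + 2)) := by ring
  · have hinv : 1 / ε ≤ (N : ℝ) ^ k := (div_le_iff₀' hε).2 hk.1
    calc (boxCount (graphOver f 0 1) ε : ℝ)
        ≤ (1 / (ε * N ^ k) + 2) * (oscSum N f 0 1 k * (1 / ε) + 2 * N ^ k) := by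
          rw [mul_one_div]; exact boxCount_le hN hf k hε
      _ ≤ (1 + 2) * (oscSum N f 0 1 k * N ^ k + 2 * (N ^ k * oscSum N f 0 1 k)) := by
          gcongr
          · exact div_le_one_of_le₀ hk.1 (by positivity)
          · exact le_mul_of_one_le_right hNk.le hosc
      _ = 9 * (N ^ k * oscSum N f 0 1 k) := by ring

end BoxCount

/-! ### Box dimension of a graph -/

section BoxDim

variable {N : ℕ} {f : ℝ → ℝ} {l : ℝ}

theorem hasBoxDim_of_tendsto {E : Set (ℝ × ℝ)} {d : ℝ}
    (h : Tendsto (fun ε : ℝ => Real.log (boxCount E ε) / Real.log (1 / ε)) (𝓝[>] 0) (𝓝 d)) :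
    HasBoxDim E d :=
  have h' := (continuous_coe_real_ereal.tendsto d).comp h
  ⟨h'.limsup_eq, h'.liminf_eq⟩

/-- The least `k` with `N ^ (-k) ≤ ε`, for `N ≥ 2` and `ε ∈ (0, 1]`. -/
noncomputable def gridLevel (N : ℕ) (ε : ℝ) : ℕ := ⌈Real.logb N (1 / ε)⌉₊

theorem tendsto_log_one_div : Tendsto (fun ε : ℝ => Real.log (1 / ε)) (𝓝[>] 0) atTop := by
  simp only [one_div]
  exact Real.tendsto_log_atTop.comp tendsto_inv_nhdsGT_zero

theorem gridLevel_eq (N : ℕ) (ε : ℝ) : gridLevel N ε = ⌈(Real.log N)⁻¹ * Real.log (1 / ε)⌉₊ := by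
  rw [gridLevel, Real.logb, div_eq_inv_mul]

theorem tendsto_gridLevel (hN : 1 < N) : Tendsto (gridLevel N) (𝓝[>] 0) atTop := by
  simp only [funext (gridLevel_eq N)]
  exact tendsto_nat_ceil_atTop.comp (tendsto_log_one_div.const_mul_atTop
    (inv_pos.2 (Real.log_pos (Nat.one_lt_cast.2 hN))))

theorem tendsto_gridLevel_div_log (hN : 1 < N) :
    Tendsto (fun ε => gridLevel N ε / Real.log (1 / ε)) (𝓝[>] 0) (𝓝 (Real.log N)⁻¹) := by
  simp only [gridLevel_eq]
  exact (tendsto_nat_ceil_mul_div_atTop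
    (inv_nonneg.2 (Real.log_pos (Nat.one_lt_cast.2 hN)).le)).comp tendsto_log_one_div

theorem mul_pow_gridLevel_mem_Icc (hN : 1 < N) {ε : ℝ} (hε : 0 < ε) (hε1 : ε ≤ 1) :
    ε * N ^ gridLevel N ε ∈ Icc 1 (N : ℝ) := by
  have hN1 : (1 : ℝ) < N := Nat.one_lt_cast.2 hN
  have hinv : 0 < 1 / ε := one_div_pos.2 hε
  have hlow : 1 / ε ≤ (N : ℝ) ^ gridLevel N ε := by
    rw [← Real.rpow_natCast, ← Real.logb_le_iff_le_rpow hN1 hinv]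
    exact Nat.le_ceil _
  have hup : (N : ℝ) ^ gridLevel N ε ≤ N / ε := by
    rw [← Real.rpow_natCast, ← Real.le_logb_iff_rpow_le hN1 (by positivity), div_eq_mul_one_div,
      Real.logb_mul (by positivity) hinv.ne', Real.logb_self_eq_one hN1, add_comm]
    exact (Nat.ceil_lt_add_one (Real.logb_nonneg hN1 ((one_le_div hε).2 hε1))).le
  exact ⟨(div_le_iff₀' hε).1 hlow, (le_div_iff₀' hε).1 hup⟩

theorem tendsto_log_mul_oscSum_div_log (hN : 1 < N)
    (htop : Tendsto (oscSum N f 0 1) atTop atTop)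
    (hl : Tendsto (fun k : ℕ => Real.log (oscSum N f 0 1 k) / k) atTop (𝓝 l)) {c : ℝ} (hc : 0 < c) :
    Tendsto (fun ε => Real.log (c * (N ^ gridLevel N ε * oscSum N f 0 1 (gridLevel N ε))) /
      Real.log (1 / ε)) (𝓝[>] 0) (𝓝 (1 + l / Real.log N)) := by
  have hlogN : Real.log N ≠ 0 := (Real.log_pos (Nat.one_lt_cast.2 hN)).ne'
  have hκ := tendsto_gridLevel hN
  have hsum : Tendsto (fun ε => Real.log c / Real.log (1 / ε) +
      gridLevel N ε / Real.log (1 / ε) *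
        (Real.log N + Real.log (oscSum N f 0 1 (gridLevel N ε)) / (gridLevel N ε : ℕ)))
      (𝓝[>] 0) (𝓝 (0 + (Real.log N)⁻¹ * (Real.log N + l))) :=
    (tendsto_const_nhds.div_atTop tendsto_log_one_div).add
      ((tendsto_gridLevel_div_log hN).mul ((hl.comp hκ).const_add _))
  rw [zero_add, mul_add, inv_mul_cancel₀ hlogN, ← div_eq_inv_mul] at hsum
  refine hsum.congr' ?_
  filter_upwards [hκ.eventually (htop.eventually_gt_atTop 0), hκ.eventually_ne_atTop 0]
    with ε hosc hk
  rw [Real.log_mul hc.ne' (by positivity), Real.log_mul (by positivity) hosc.ne', Real.log_pow]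
  field_simp

theorem hasBoxDim_graphOver (hN : 1 < N) (hf : ContinuousOn f (Icc 0 1))
    (htop : Tendsto (oscSum N f 0 1) atTop atTop)
    (hl : Tendsto (fun k : ℕ => Real.log (oscSum N f 0 1 k) / k) atTop (𝓝 l)) :
    HasBoxDim (graphOver f 0 1) (1 + l / Real.log N) := by
  have hN0 : 0 < N := zero_lt_one.trans hN
  refine hasBoxDim_of_tendsto (tendsto_of_tendsto_of_tendsto_of_le_of_le'
    (tendsto_log_mul_oscSum_div_log hN htop hl (c := 1 / (N * (N + 2))) (by positivity))
    (tendsto_log_mul_oscSum_div_log hN htop hl (c := 9) (by norm_num)) ?_ ?_)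
  all_goals
    filter_upwards [Ioc_mem_nhdsGT zero_lt_one,
      (tendsto_gridLevel hN).eventually (htop.eventually_ge_atTop 1)] with ε hε hosc
    have := zero_lt_one.trans_le hosc
    obtain ⟨hlow, hup⟩ := boxCount_mem_Icc hN0 hf hε.1 (mul_pow_gridLevel_mem_Icc hN hε.1 hε.2) hosc
    have hcount : 0 < (boxCount (graphOver f 0 1) ε : ℝ) := lt_of_lt_of_le (by positivity) hlow
    have hlog : 0 ≤ Real.log (1 / ε) := Real.log_nonneg ((one_le_div hε.1).2 hε.2)
    gcongr

end BoxDim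

end GenAffineFIF

open GenAffineFIF in
theorem theorem4p11_general {N : ℕ} (hN : 2 ≤ N) {y : Fin (N + 1) → ℝ} (hy0 : y 0 = 0)
    (hyN : y (Fin.last N) = 0) {S f : ℝ → ℝ} {L : NNReal} (hS : LipschitzOnWith L S (Icc 0 1))
    (hSpos : ∀ t ∈ Icc 0 1, 0 < S t) (hf : IsGenAffineFIF (unifNodes N) y S f)
    (hγ : 1 < gammaMin N S)
    (hosc : ∃ k, L * maxAbs f / (gammaMin N S - 1) < oscSum N f 0 1 k) :
    ∃ ρ : ℝ, IsRhoS N S ρ ∧ 0 < ρ ∧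
      HasBoxDim (graphOver f 0 1) (1 + Real.log ρ / Real.log N) := by
  have hN0 : 0 < N := by lia
  have : Nonempty (Fin N) := ⟨⟨0, hN0⟩⟩
  have hS0 : ∀ t ∈ Icc 0 1, 0 ≤ S t := fun t ht => (hSpos t ht).le
  have hcont := hf.continuousOn_Icc hN0
  have hself := hf.selfAffine hN0 hy0 hyN
  obtain ⟨K_S, hSlog⟩ := exists_logLipschitzOn isCompact_Icc hS hSpos
  obtain ⟨ρ, K, φ, hρ0, hφ, hρ⟩ := exists_eigenfunction (Metric.isBounded_Icc 0 1)
    (nonempty_Icc.2 zero_le_one) mapsTo_branch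
    (fun i => (lipschitzWith_branch i).lipschitzOnWith)
    (inv_lt_one_of_one_lt₀ (Nat.one_lt_cast.2 hN)) hSlog
  have hρ1 : 1 < ρ := hγ.trans_le (gammaMin_le_of_transfer_eq_mul hS0 hφ hρ)
  have htop := hself.tendsto_oscSum_atTop hN0 (sum_slopes_eq_zero hy0 hyN) hS hS0 hcont hγ hosc
  have hΘ := hself.oscSum_isTheta_pow hN0 hS hS0 hcont htop hφ hρ hρ1
  exact ⟨ρ, isRhoS_of_transfer_eq_mul hN hSlog hφ hρ0.le hρ, hρ0,
    hasBoxDim_graphOver hN hcont htop (tendsto_log_div_of_isTheta_pow hρ0 hΘ)⟩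

theorem theorem4p11 (N : ℕ) (hN : 2 ≤ N)
    (y : Fin (N + 1) → ℝ) (hy0 : y 0 = 0) (hyN : y (Fin.last N) = 0)
    (S f : ℝ → ℝ) (lamS : ℝ) (hlam : 0 < lamS)
    (hSlip : ∀ s ∈ Set.Icc (0 : ℝ) 1, ∀ t ∈ Set.Icc (0 : ℝ) 1, |S s - S t| ≤ lamS * |s - t|)
    (hSlt : ∀ t ∈ Set.Icc (0 : ℝ) 1, |S t| < 1)
    (hSpos : ∀ t ∈ Set.Icc (0 : ℝ) 1, 0 < S t)
    (hf : GenAffineFIF.IsGenAffineFIF (GenAffineFIF.unifNodes N) y S f)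
    (hγ : 1 < GenAffineFIF.gammaMin N S)
    (hosc : ∃ k₀ : ℕ, 1 ≤ k₀ ∧
      lamS * GenAffineFIF.maxAbs f / (GenAffineFIF.gammaMin N S - 1) <
        GenAffineFIF.oscSum N f 0 1 k₀) :
    ∃ ρS : ℝ, GenAffineFIF.IsRhoS N S ρS ∧ 0 < ρS ∧
      GenAffineFIF.HasBoxDim (GenAffineFIF.graphOver f 0 1)
        (1 + Real.log ρS / Real.log N) := by
  lift lamS to NNReal using hlam.le
  obtain ⟨k₀, -, hk₀⟩ := hosc
  exact theorem4p11_general hN hy0 hyN (LipschitzOnWith.of_dist_le_mul hSlip) hSpos hf hγ ⟨k₀, hk₀⟩
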